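/- Let $n\ge 1$, let $B^n$ be the open Euclidean unit ball of $\mathbb C^n$, and let $A:\mathbb C^n\to\mathbb C^n$ be linear with $m(A):=\min\{\Re\langle A z,z\rangle:\|z\|=1\}>0$. Let $\mathcal H_A(B^n)$ be the class of maps $h:B^n\times[0,\infty)\to\mathbb C^n$ such that for every $t\ge 0$ the map $h(\cdot,t)$ is holomorphic on $B^n$ with $\Re\langle h(z,t),z\rangle>0$ for $z\in B^n\setminus\{0\}$ and $Dh(0,t)=A$, and such that $h(z,\cdot)$ is measurable on $[0,\infty)$ for every $z\in B^n$. Let $h\in\mathcal H_A(B^n)$ and let $f:B^n\times[0,\infty)\to\mathbb C^n$ be a solution of the Loewner chain equation $$\frac{\partial f}{\partial t}(z,t)=Df(z,t)\,h(z,t)\quad\text{for a.e. } t\ge 0,\ z\in B^n,$$ where $D$ is the derivative in $z$; that is, $f(\cdot,t)$ is holomorphic on $B^n$ for every $t\ge0$, $f(z,\cdot)$ is locally absolutely continuous on $[0,\infty)$ locally uniformly with respect to $z\in B^n$, and for every $z\in B^n$ the equation holds for almost every $t\ge 0$. Assume that $f$ is normalized by $f(0,0)=0$, $Df(0,0)=I$,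 and that $f$ is polynomially bounded: for every compact $K\subset B^n$ there are a constant $C_K$ and a polynomial $P$ (which may depend on $K$) with $$\|e^{-tA}f(z,t)\|\le C_K\,P(t),\qquad z\in K,\ t\ge 0.$$ Then $f$ is a Loewner chain: $f(\cdot,t)$ is univalent (holomorphic and injective) on $B^n$ for every $t\ge0$, and for all $0\le s\le t$ there is a holomorphic map $v(\cdot,s,t):B^n\to B^n$ with $v(0,s,t)=0$ and $f(z,s)=f(v(z,s,t),t)$ for all $z\in B^n$. -/

import Mathlib

open MeasureTheory Set Metric

noncomputable section

namespace LoewnerPDE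

/-- `ℂⁿ` with the Euclidean inner product and norm. -/
abbrev Cn (n : ℕ) : Type := EuclideanSpace ℂ (Fin n)

/-- The open Euclidean unit ball of `ℂⁿ`. -/
abbrev unitBall (n : ℕ) : Set (Cn n) := ball 0 1

/-- `m(A) = min {Re ⟨A z, z⟩ : ‖z‖ = 1}` (for `n ≥ 1` the sphere is compact and nonempty,
so that the infimum is attained). -/
def lowerIndex {n : ℕ} (A : Cn n →L[ℂ] Cn n) : ℝ :=
  sInf ((fun z : Cn n => (inner ℂ (A z) z).re) '' sphere 0 1)

/-- The class `𝒩_A`: holomorphic maps `h` on the ball with `Re ⟨h z, z⟩ > 0` for `z ≠ 0` and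
`Dh(0) = A`. (That `h 0 = 0` follows from the positivity.) -/
structure MemNA {n : ℕ} (A : Cn n →L[ℂ] Cn n) (h : Cn n → Cn n) : Prop where
  holo : DifferentiableOn ℂ h (unitBall n)
  re_pos : ∀ z ∈ unitBall n, z ≠ 0 → 0 < (inner ℂ (h z) z).re
  deriv_zero : fderiv ℂ h 0 = A

/-- The class `ℋ_A(Bⁿ)` of infinitesimal generators `h(z,t)`, `z ∈ Bⁿ`, `t ≥ 0`. Almost everywhere
measurability for Lebesgue measure is Lebesgue measurability. -/
structure MemHA {n : ℕ} (A : Cn n →L[ℂ] Cn n) (h : Cn n → ℝ → Cn n) : Prop where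
  memNA : ∀ t : ℝ, 0 ≤ t → MemNA A (fun z => h z t)
  meas : ∀ z ∈ unitBall n, AEMeasurable (h z) (volume.restrict (Ici (0 : ℝ)))

/-- `f(z,t)` is locally absolutely continuous in `t ∈ [0,∞)`, locally uniformly with respect to
`z ∈ Bⁿ`: on each `[0,T]` the `ε`-`δ` condition of absolute continuity (over finite families
`E` of disjoint intervals) holds with one `δ` for all `z` in a compact set. -/
def LocUnifAC {n : ℕ} (f : Cn n → ℝ → Cn n) : Prop :=
  ∀ K : Set (Cn n), IsCompact K → K ⊆ unitBall n → ∀ T : ℝ, 0 ≤ T →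
    ∀ ε > (0 : ℝ), ∃ δ > (0 : ℝ), ∀ z ∈ K,
      ∀ E ∈ AbsolutelyContinuousOnInterval.disjWithin 0 T,
        ∑ i ∈ Finset.range E.1, dist (E.2 i).1 (E.2 i).2 < δ →
        ∑ i ∈ Finset.range E.1, dist (f z (E.2 i).1) (f z (E.2 i).2) < ε

/-- `f` solves the Loewner chain equation `∂f/∂t (z,t) = Df(z,t) h(z,t)`, a.e. `t ≥ 0`, `z ∈ Bⁿ`,
where `D` is the complex derivative in `z`. The exceptional null set may depend on `z`. -/
structure IsSolution {n : ℕ} (h f : Cn n → ℝ → Cn n) : Prop where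
  holo : ∀ t : ℝ, 0 ≤ t → DifferentiableOn ℂ (fun z => f z t) (unitBall n)
  locUnifAC : LocUnifAC f
  eqn : ∀ z ∈ unitBall n, ∀ᵐ t ∂(volume.restrict (Ici (0 : ℝ))),
    HasDerivAt (f z) (fderiv ℂ (fun w => f w t) z (h z t)) t

/-- `f(0,0) = 0` and `Df(0,0) = I`. -/
structure IsNormalized {n : ℕ} (f : Cn n → ℝ → Cn n) : Prop where
  zero : f 0 0 = 0
  deriv : fderiv ℂ (fun z => f z 0) 0 = ContinuousLinearMap.id ℂ (Cn n)

/-- `{e^{-tA} f(·,t)}_{t ≥ 0}` is locally polynomially bounded. -/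
def PolyBounded {n : ℕ} (A : Cn n →L[ℂ] Cn n) (f : Cn n → ℝ → Cn n) : Prop :=
  ∀ K : Set (Cn n), IsCompact K → K ⊆ unitBall n →
    ∃ (C : ℝ) (P : Polynomial ℝ), ∀ z ∈ K, ∀ t : ℝ, 0 ≤ t →
      ‖NormedSpace.exp ((-t : ℂ) • A) (f z t)‖ ≤ C * P.eval t

/-- `f` is a Loewner chain: each `f(·,t)` is univalent (holomorphic and injective) on `Bⁿ`, and
`f(z,s) = f(v(z,s,t),t)` for `0 ≤ s ≤ t`, where `v(·,s,t)` is a holomorphic self-map of `Bⁿ`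
fixing `0`. -/
structure IsLoewnerChain {n : ℕ} (f : Cn n → ℝ → Cn n) : Prop where
  holo : ∀ t : ℝ, 0 ≤ t → DifferentiableOn ℂ (fun z => f z t) (unitBall n)
  inj : ∀ t : ℝ, 0 ≤ t → InjOn (fun z => f z t) (unitBall n)
  subord : ∃ v : Cn n → ℝ → ℝ → Cn n, ∀ s t : ℝ, 0 ≤ s → s ≤ t →
    DifferentiableOn ℂ (fun z => v z s t) (unitBall n) ∧
    MapsTo (fun z => v z s t) (unitBall n) (unitBall n) ∧
    v 0 s t = 0 ∧
    ∀ z ∈ unitBall n, f z s = f (v z s t) t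

end LoewnerPDE

end

/-! The proof compares `f` with the evolution family `v` of the generator, where `t ↦ v z s t`
solves `u' = -h(u,t)`, `u(s) = z`. A solution of the Loewner equation is constant along these
trajectories, so `f (v z s T) T = f z s` for all `T ≥ s`. Univalence of `f(·,s)` thus follows from
injectivity of `v(·,s,T)` and of `f(·,T)` on the image of a compact ball under `v(·,s,T)`, for one
suitable large `T`.

Two rates compete. Restricting `h` to complex lines gives functions of positive real part; the
Schwarz lemma bounds `h` on smaller balls uniformly in `t` and makes `v` decay exponentially: points
with `‖z‖ ≤ r` satisfy `‖v z s T‖ ≤ e^{-c(T-s)}` with `c = (1-r²)m(A)/4`. On the other side `Df(0,T)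
= e^{TA}`, so `e^{-TA} f(·,T)` has derivative `I` at `0` and is bounded by a polynomial in `T` on a
fixed ball. Cauchy estimates keep its derivative within `1/2` of `I` on a ball whose radius shrinks
only like the reciprocal of that polynomial. The exponential wins, and `f(·,T)` is injective with
invertible derivative where it is needed (`IsSolution.eventually_injOn`).

Holomorphy of `v` is also read off from `f`: `v(·,s,T)` is Lipschitz and solves `f(v,T) = f(·,s)`
where `Df(·,T)` is invertible, hence is complex differentiable; intermediate times follow from
`v(v(z,s,t),t,T) = v(z,s,T)`.

The null set in the Loewner equation depends on `z`, so the chain rule is not available along a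
moving trajectory. Instead the equation is integrated at a fixed point over a short interval, and
increments of size `O((b-a)²)` force the relevant quantities to be constant or monotone
(`le_of_increment_le_sq`). -/

namespace LoewnerPDE

open Filter Topology

/-! ### Quadratic increments and absolutely continuous curves -/

/-- A function whose increments are bounded above quadratically does not increase. -/
theorem le_of_increment_le_sq {φ : ℝ → ℝ} {C a b : ℝ} (hab : a ≤ b)
    (h : ∀ x y, a ≤ x → x ≤ y → y ≤ b → φ y - φ x ≤ C * (y - x) ^ 2) : φ b ≤ φ a := by
  -- Splitting an interval at its midpoint halves the sum of the squared lengths, so the bound gains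
  -- a factor `1/2` at each round.
  have key : ∀ N : ℕ, ∀ x y, a ≤ x → x ≤ y → y ≤ b →
      φ y - φ x ≤ C * (y - x) ^ 2 * (1 / 2) ^ N := by
    intro N
    induction N with
    | zero => intro x y h1 h2 h3; simpa using h x y h1 h2 h3
    | succ N ih =>
      intro x y h1 h2 h3
      have e1 := ih x ((x + y) / 2) h1 (by linarith) (by linarith)
      have e2 := ih ((x + y) / 2) y (by linarith) (by linarith) h3
      calc φ y - φ x ≤ C * (y - (x + y) / 2) ^ 2 * (1 / 2) ^ N
            + C * ((x + y) / 2 - x) ^ 2 * (1 / 2) ^ N := by linarith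
        _ = C * (y - x) ^ 2 * (1 / 2) ^ (N + 1) := by rw [pow_succ]; ring
  have hlim : Tendsto (fun N : ℕ => C * (b - a) ^ 2 * (1 / 2 : ℝ) ^ N) atTop (𝓝 0) := by
    simpa using (tendsto_pow_atTop_nhds_zero_of_lt_one (r := (1 / 2 : ℝ)) (by norm_num)
      (by norm_num)).const_mul (C * (b - a) ^ 2)
  have := ge_of_tendsto' hlim (fun N => key N a b le_rfl hab le_rfl)
  linarith

theorem eq_of_norm_increment_le_sq {E : Type*} [NormedAddCommGroup E] {φ : ℝ → E} {C a b : ℝ}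
    (hab : a ≤ b)
    (h : ∀ x y, a ≤ x → x ≤ y → y ≤ b → ‖φ y - φ x‖ ≤ C * (y - x) ^ 2) : φ b = φ a := by
  have := le_of_increment_le_sq (φ := fun x => ‖φ x - φ a‖) (C := C) hab (fun x y h1 h2 h3 => by
    refine le_trans ?_ (h x y h1 h2 h3)
    simpa using norm_sub_norm_le (φ y - φ a) (φ x - φ a))
  simpa [sub_eq_zero] using this

theorem AbsolutelyContinuousOnInterval.clm_comp {E F : Type*} [NormedAddCommGroup E]
    [NormedSpace ℝ E] [NormedAddCommGroup F] [NormedSpace ℝ F] {ψ : ℝ → E} {a b : ℝ}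
    (hψ : AbsolutelyContinuousOnInterval ψ a b) (g : E →L[ℝ] F) :
    AbsolutelyContinuousOnInterval (fun t => g (ψ t)) a b := by
  apply squeeze_zero (fun t ↦ ?_) (fun t ↦ ?_) (by simpa using Tendsto.const_mul ‖g‖ hψ)
  · exact Finset.sum_nonneg (fun i hi ↦ by positivity)
  · rw [Finset.mul_sum]
    gcongr
    simpa [dist_eq_norm, ← map_sub] using g.le_opNorm _

/-- The mean value inequality for absolutely continuous functions. -/
theorem norm_sub_le_of_ae_hasDerivAt {E : Type*} [NormedAddCommGroup E]
    [NormedSpace ℝ E] {ψ : ℝ → E} {a b M : ℝ} (hab : a ≤ b)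
    (hψ : AbsolutelyContinuousOnInterval ψ a b)
    (hd : ∀ᵐ t, t ∈ Icc a b → ∃ d, HasDerivAt ψ d t ∧ ‖d‖ ≤ M) :
    ‖ψ b - ψ a‖ ≤ M * (b - a) := by
  -- A norming functional reduces the claim to the fundamental theorem for real absolutely
  -- continuous functions.
  obtain ⟨g, hg1, hg2⟩ := exists_dual_vector'' ℝ (ψ b - ψ a)
  have h1 := (AbsolutelyContinuousOnInterval.clm_comp hψ g).integral_deriv_eq_sub
  have h2 : ‖∫ t in a..b, deriv (fun t => g (ψ t)) t‖ ≤ M * |b - a| := by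
    apply intervalIntegral.norm_integral_le_of_norm_le_const_ae
    filter_upwards [hd] with t ht htm
    rw [uIoc_of_le hab] at htm
    obtain ⟨d, hd1, hd2⟩ := ht (Ioc_subset_Icc_self htm)
    have : HasDerivAt (fun t => g (ψ t)) (g d) t := g.hasFDerivAt.comp_hasDerivAt t hd1
    rw [this.deriv]
    calc ‖g d‖ ≤ ‖g‖ * ‖d‖ := g.le_opNorm d
      _ ≤ 1 * ‖d‖ := by gcongr
      _ ≤ M := by linarith
  rw [h1, ← map_sub, hg2, abs_of_nonneg (by linarith)] at h2
  simpa using h2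

/-! ### Cauchy estimates for bounded holomorphic maps on a ball -/

section Cauchy

variable {E F : Type*} [NormedAddCommGroup E] [NormedSpace ℂ E] [NormedAddCommGroup F]
  [NormedSpace ℂ F]

theorem norm_fderiv_le_of_bounded {f : E → F} {x : E} {d M : ℝ} (hd : 0 < d)
    (hf : DifferentiableOn ℂ f (ball x d)) (hM : ∀ y ∈ ball x d, ‖f y‖ ≤ M) :
    ‖fderiv ℂ f x‖ ≤ 2 * M / d := by
  refine Complex.norm_fderiv_le_div_of_mapsTo_ball hf (fun y hy => ?_) hd
  rw [mem_closedBall, dist_eq_norm]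
  linarith [norm_sub_le (f y) (f x), hM y hy, hM x (mem_ball_self hd)]

variable {f : E → F} {r R M : ℝ} (hrR : r < R) (hf : DifferentiableOn ℂ f (ball 0 R))
  (hM : ∀ y ∈ ball (0 : E) R, ‖f y‖ ≤ M)

include hrR hf hM

theorem norm_fderiv_le_of_bounded_ball {x : E} (hx : ‖x‖ ≤ r) :
    ‖fderiv ℂ f x‖ ≤ 2 * M / (R - r) := by
  have hsub : ball x (R - r) ⊆ ball 0 R := by
    intro y hy
    rw [mem_ball, dist_eq_norm] at hy
    rw [mem_ball_zero_iff]
    have := norm_add_le (y - x) x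
    rw [sub_add_cancel] at this
    linarith
  exact norm_fderiv_le_of_bounded (by linarith) (hf.mono hsub) (fun y hy => hM y (hsub hy))

theorem norm_sub_le_of_bounded_ball {x y : E} (hx : ‖x‖ ≤ r) (hy : ‖y‖ ≤ r) :
    ‖f y - f x‖ ≤ 2 * M / (R - r) * ‖y - x‖ := by
  refine Convex.norm_image_sub_le_of_norm_fderiv_le (𝕜 := ℂ) (s := closedBall 0 r) ?_ ?_
    (convex_closedBall _ _) (by simpa using hx) (by simpa using hy)
  · intro w hw
    refine hf.differentiableAt (isOpen_ball.mem_nhds ?_)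
    rw [mem_closedBall_zero_iff] at hw
    rw [mem_ball_zero_iff]; linarith
  · intro w hw
    exact norm_fderiv_le_of_bounded_ball hrR hf hM (by simpa using hw)

/-- The first-order estimate is used twice: the translate difference `w ↦ f (w + (y - x)) - f w` is
`O(‖y - x‖)` on a ball of radius `d = (R - r)/2`, and its derivative at `x` is the difference
sought. The constant is `2 · (2M/d)/d = 16M/(R - r)²`. -/
theorem norm_fderiv_sub_le_of_bounded_ball {x y : E} (hx : ‖x‖ ≤ r) (hy : ‖y‖ ≤ r) :
    ‖fderiv ℂ f y - fderiv ℂ f x‖ ≤ 16 * M / (R - r) ^ 2 * ‖y - x‖ := by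
  set d := (R - r) / 2 with hd
  have hd0 : 0 < d := by rw [hd]; linarith
  have hb : ∀ w ∈ ball x d, ‖w‖ ≤ r + d ∧ ‖w + (y - x)‖ ≤ r + d := by
    intro w hw
    rw [mem_ball, dist_eq_norm] at hw
    have h1 := norm_add_le (w - x) x
    have h2 := norm_add_le (w - x) y
    rw [sub_add_cancel] at h1
    rw [show w - x + y = w + (y - x) by abel] at h2
    constructor <;> linarith
  have hdiff : ∀ w : E, ‖w‖ ≤ r + d → DifferentiableAt ℂ f w := fun w hw =>
    hf.differentiableAt (isOpen_ball.mem_nhds (by rw [mem_ball_zero_iff]; linarith))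
  have hdg : ∀ w ∈ ball x d, HasFDerivAt (fun w => f (w + (y - x)) - f w)
      (fderiv ℂ f (w + (y - x)) - fderiv ℂ f w) w := by
    intro w hw
    refine HasFDerivAt.sub ?_ (hdiff w (hb w hw).1).hasFDerivAt
    exact (hasFDerivAt_comp_add_right (y - x)).2 (hdiff _ (hb w hw).2).hasFDerivAt
  have key := norm_fderiv_le_of_bounded (f := fun w => f (w + (y - x)) - f w) (x := x) hd0
    (M := 2 * M / d * ‖y - x‖)
    (fun w hw => (hdg w hw).differentiableAt.differentiableWithinAt) (fun w hw => by
      have := norm_sub_le_of_bounded_ball (r := r + d) (by linarith) hf hM (hb w hw).1 (hb w hw).2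
      rwa [add_sub_cancel_left, show R - (r + d) = d by rw [hd]; ring] at this)
  rw [(hdg x (mem_ball_self hd0)).fderiv, add_sub_cancel] at key
  refine key.trans_eq ?_
  have : R - r ≠ 0 := by linarith
  rw [hd]; field_simp; ring

theorem norm_taylor_le_of_bounded_ball {x y : E} (hx : ‖x‖ ≤ r) (hy : ‖y‖ ≤ r) :
    ‖f y - f x - fderiv ℂ f x (y - x)‖ ≤ 16 * M / (R - r) ^ 2 * ‖y - x‖ ^ 2 := by
  have hM0 : 0 ≤ M := by
    refine (norm_nonneg (f x)).trans (hM x ?_)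
    rw [mem_ball_zero_iff]; linarith
  have hseg : ∀ w ∈ segment ℝ x y, ‖w‖ ≤ r := fun w hw => by
    simpa using (convex_closedBall (0 : E) r).segment_subset (by simpa using hx)
      (by simpa using hy) hw
  have := Convex.norm_image_sub_le_of_norm_hasFDerivWithin_le' (𝕜 := ℂ) (f := f)
    (f' := fderiv ℂ f) (s := segment ℝ x y) (φ := fderiv ℂ f x)
    (C := 16 * M / (R - r) ^ 2 * ‖y - x‖) (x := x) (y := y) ?_ ?_ (convex_segment x y)
    (left_mem_segment ℝ x y) (right_mem_segment ℝ x y)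
  · refine this.trans_eq (by ring)
  · intro w hw
    refine (hf.differentiableAt (isOpen_ball.mem_nhds ?_)).hasFDerivAt.hasFDerivWithinAt
    rw [mem_ball_zero_iff]; linarith [hseg w hw]
  · intro w hw
    refine (norm_fderiv_sub_le_of_bounded_ball hrR hf hM hx (hseg w hw)).trans ?_
    have : ‖w - x‖ ≤ ‖y - x‖ := by
      have := norm_sub_le_of_mem_segment hw
      simpa [norm_sub_rev] using this
    gcongr

end Cauchy

/-! ### Differentiability of an inner factor -/

/-- If `F = f ∘ v` with `F` and `f` differentiable, the derivative of `f` invertible, and `v`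
Lipschitz at the point, then `v` is differentiable. -/
theorem differentiableAt_of_comp_eq {E : Type*} [NormedAddCommGroup E] [NormedSpace ℂ E]
    {f v F : E → E} {z : E} {L : E ≃L[ℂ] E} {C : ℝ}
    (hf : HasFDerivAt f (L : E →L[ℂ] E) (v z)) (hF : DifferentiableAt ℂ F z)
    (hv : ∀ᶠ w in 𝓝 z, ‖v w - v z‖ ≤ C * ‖w - z‖) (hc : ∀ᶠ w in 𝓝 z, f (v w) = F w) :
    DifferentiableAt ℂ v z := by
  have hO : (fun w => v w - v z) =O[𝓝 z] fun w => w - z := Asymptotics.IsBigO.of_bound C hv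
  have hcont : Tendsto v (𝓝 z) (𝓝 (v z)) := by
    rw [tendsto_iff_norm_sub_tendsto_zero]
    refine squeeze_zero' (Eventually.of_forall fun _ => norm_nonneg _) hv ?_
    have : Tendsto (fun w => C * ‖w - z‖) (𝓝 z) (𝓝 (C * ‖z - z‖)) := by
      apply Continuous.tendsto; fun_prop
    simpa using this
  have h1 := ((hasFDerivAt_iff_isLittleO.1 hf).comp_tendsto hcont).trans_isBigO hO
  have h2 := hasFDerivAt_iff_isLittleO.1 hF.hasFDerivAt
  have h3 := (L.symm : E →L[ℂ] E).isBigO_comp (fun w => (F w - F z - fderiv ℂ F z (w - z)) -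
    (f (v w) - f (v z) - L (v w - v z))) (𝓝 z)
  have h4 := h3.trans_isLittleO (h2.sub h1)
  refine HasFDerivAt.differentiableAt
    (f' := (L.symm : E →L[ℂ] E) ∘L fderiv ℂ F z) (hasFDerivAt_iff_isLittleO.2 ?_)
  refine h4.congr' ?_ EventuallyEq.rfl
  filter_upwards [hc] with w hw
  have hz : f (v z) = F z := hc.self_of_nhds
  rw [hw, hz]
  simp

theorem exists_equiv_of_lower_bound {n : ℕ} (D : Cn n →L[ℂ] Cn n) {c : ℝ} (hc : 0 < c)
    (h : ∀ x, c * ‖x‖ ≤ ‖D x‖) : ∃ L : Cn n ≃L[ℂ] Cn n, (L : Cn n →L[ℂ] Cn n) = D := by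
  have hinj : Function.Injective (D : Cn n →ₗ[ℂ] Cn n) := by
    rw [injective_iff_map_eq_zero]
    intro x hx
    have := h x
    rw [show D x = 0 from hx, norm_zero] at this
    exact norm_le_zero_iff.1 (nonpos_of_mul_nonpos_right this hc)
  refine ⟨(LinearEquiv.ofInjectiveEndo _ hinj).toContinuousLinearEquiv, ?_⟩
  ext x : 1
  rfl

end LoewnerPDE

/-! ### Estimates for generators with positive real part -/

namespace LoewnerPDE

open Filter Topology

theorem lowerIndex_le {n : ℕ} (A : Cn n →L[ℂ] Cn n) {u : Cn n} (hu : ‖u‖ = 1) :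
    lowerIndex A ≤ (inner ℂ (A u) u).re := by
  refine csInf_le ⟨-‖A‖, ?_⟩ ⟨u, by simpa using hu, rfl⟩
  rintro _ ⟨z, hz, rfl⟩
  rw [mem_sphere_zero_iff_norm] at hz
  have h1 := (Complex.abs_re_le_norm (inner ℂ (A z) z)).trans (norm_inner_le_norm (A z) z)
  have h2 := A.le_opNorm z
  rw [hz, mul_one] at h1 h2
  exact (abs_le.1 (h1.trans h2)).1

/-- The Schwarz lemma for the Cayley transform of a function with positive real part. -/
theorem norm_sub_le_mul_norm_add_conj {p : ℂ → ℂ} (hp : DifferentiableOn ℂ p (ball 0 1))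
    (hpos : ∀ ζ ∈ ball (0 : ℂ) 1, 0 < (p ζ).re) {ζ : ℂ} (hζ : ζ ∈ ball (0 : ℂ) 1) :
    ‖p ζ - p 0‖ ≤ ‖ζ‖ * ‖p ζ + (starRingEnd ℂ) (p 0)‖ := by
  have h0 := hpos 0 (mem_ball_self one_pos)
  have hne : ∀ ξ ∈ ball (0 : ℂ) 1, p ξ + (starRingEnd ℂ) (p 0) ≠ 0 := by
    intro ξ hξ h
    have := congrArg Complex.re h
    simp at this
    linarith [hpos ξ hξ]
  have key := Complex.norm_le_norm_of_mapsTo_ball (R := 1) (z := ζ)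
    (f := fun ξ => (p ξ - p 0) / (p ξ + (starRingEnd ℂ) (p 0)))
    ((hp.sub_const _).div (hp.add_const _) hne) ?_ (by simp) (by simpa using hζ)
  · rw [norm_div, div_le_iff₀ (norm_pos_iff.2 (hne ζ hζ))] at key
    exact key
  · intro ξ hξ
    rw [mem_closedBall_zero_iff, norm_div, div_le_one (norm_pos_iff.2 (hne ξ hξ))]
    have h1 := hpos ξ hξ
    refine (sq_le_sq₀ (norm_nonneg _) (norm_nonneg _)).1 ?_
    rw [← Complex.normSq_eq_norm_sq, ← Complex.normSq_eq_norm_sq, Complex.normSq_apply,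
      Complex.normSq_apply]
    simp
    nlinarith

theorem norm_le_of_re_pos {p : ℂ → ℂ} (hp : DifferentiableOn ℂ p (ball 0 1))
    (hpos : ∀ ζ ∈ ball (0 : ℂ) 1, 0 < (p ζ).re) {ζ : ℂ} {r : ℝ} (hr : r < 1) (hζ : ‖ζ‖ ≤ r) :
    ‖p ζ‖ ≤ ‖p 0‖ * (1 + r) / (1 - r) := by
  have key := norm_sub_le_mul_norm_add_conj hp hpos (ζ := ζ)
    (by rw [mem_ball_zero_iff]; linarith)
  have h1 : ‖p ζ + (starRingEnd ℂ) (p 0)‖ ≤ ‖p ζ‖ + ‖p 0‖ := by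
    simpa using norm_add_le (p ζ) ((starRingEnd ℂ) (p 0))
  have h2 := norm_sub_norm_le (p ζ) (p 0)
  have h3 : ‖ζ‖ * ‖p ζ + (starRingEnd ℂ) (p 0)‖ ≤ r * (‖p ζ‖ + ‖p 0‖) := by
    have := (norm_nonneg _).trans hζ
    gcongr
  rw [le_div_iff₀ (by linarith)]
  linarith

theorem le_re_of_re_pos {p : ℂ → ℂ} (hp : DifferentiableOn ℂ p (ball 0 1))
    (hpos : ∀ ζ ∈ ball (0 : ℂ) 1, 0 < (p ζ).re) {ζ : ℂ} {r : ℝ} (hr : r < 1) (hζ : ‖ζ‖ ≤ r) :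
    (1 - r ^ 2) / 4 * (p 0).re ≤ (p ζ).re := by
  have hb : ζ ∈ ball (0 : ℂ) 1 := by rw [mem_ball_zero_iff]; linarith
  have key := norm_sub_le_mul_norm_add_conj hp hpos hb
  have h0 := hpos 0 (mem_ball_self one_pos)
  have h1 := hpos ζ hb
  have hr0 : 0 ≤ r := (norm_nonneg _).trans hζ
  have h2 : ‖p ζ - p 0‖ ^ 2 ≤ r ^ 2 * ‖p ζ + (starRingEnd ℂ) (p 0)‖ ^ 2 := by
    rw [← mul_pow]; gcongr; exact key.trans (by gcongr)
  rw [← Complex.normSq_eq_norm_sq, ← Complex.normSq_eq_norm_sq, Complex.normSq_apply,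
      Complex.normSq_apply] at h2
  simp only [Complex.sub_re, Complex.sub_im, Complex.add_re, Complex.add_im, Complex.conj_re,
    Complex.conj_im] at h2
  have h3 : 0 ≤ 1 - r ^ 2 := by nlinarith
  set a := (p ζ).re
  set b := (p 0).re
  set c := (p ζ).im - (p 0).im with hc
  -- With `a`, `b` the real parts, the squared Schwarz inequality reads `(a-b)² + c² ≤ r²((a+b)² +
  -- c²)`; use `(a+b)² - (a-b)² = 4ab`.
  have h4 : (1 - r ^ 2) * (a + b) ^ 2 + (1 - r ^ 2) * c ^ 2 ≤ 4 * a * b := by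
    rw [show (p ζ).im + -(p 0).im = c by rw [hc]; ring] at h2
    nlinarith
  have h5 : (1 - r ^ 2) * b ^ 2 ≤ (1 - r ^ 2) * (a + b) ^ 2 :=
    mul_le_mul_of_nonneg_left (by nlinarith) h3
  have h6 : 0 ≤ (1 - r ^ 2) * c ^ 2 := by positivity
  have h7 : ((1 - r ^ 2) / 4 * b) * b ≤ a * b := by nlinarith
  exact le_of_mul_le_mul_right h7 h0

namespace MemNA

variable {n : ℕ} {A : Cn n →L[ℂ] Cn n} {h : Cn n → Cn n}

/-- If `h 0 ≠ 0`, positivity along the ray spanned by `-h 0` gives in the limit `-‖h 0‖² ≥ 0`. -/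
theorem apply_zero (hh : MemNA A h) : h 0 = 0 := by
  have hc : ContinuousAt h 0 :=
    (hh.holo.differentiableAt (ball_mem_nhds _ one_pos)).continuousAt
  by_contra hne
  set w := -h 0 with hw
  have hw0 : w ≠ 0 := neg_ne_zero.2 hne
  have hlim : Tendsto (fun ε : ℝ => (inner ℂ (h ((ε : ℂ) • w)) w).re) (𝓝[>] 0)
      (𝓝 (inner ℂ (h 0) w).re) := by
    have h1 : Tendsto (fun ε : ℝ => (ε : ℂ) • w) (𝓝 0) (𝓝 0) := by
      have : Continuous fun ε : ℝ => (ε : ℂ) • w := by fun_prop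
      simpa using this.tendsto 0
    have h2 : Tendsto (fun ε : ℝ => h ((ε : ℂ) • w)) (𝓝 0) (𝓝 (h 0)) := hc.tendsto.comp h1
    exact ((Complex.continuous_re.tendsto _).comp (h2.inner tendsto_const_nhds)).mono_left
      nhdsWithin_le_nhds
  have hev : ∀ᶠ ε : ℝ in 𝓝[>] 0, 0 ≤ (inner ℂ (h ((ε : ℂ) • w)) w).re := by
    have h1 : ∀ᶠ ε : ℝ in 𝓝[>] 0, ε < 1 / ‖w‖ :=
      nhdsWithin_le_nhds (Iio_mem_nhds (by positivity))
    filter_upwards [h1, self_mem_nhdsWithin] with ε h1 h2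
    have h2 : 0 < ε := h2
    have h3 : (ε : ℂ) • w ∈ unitBall n := by
      rw [mem_ball_zero_iff, norm_smul, Complex.norm_real, Real.norm_of_nonneg h2.le]
      rwa [lt_div_iff₀ (by positivity)] at h1
    have h4 := hh.re_pos _ h3 (smul_ne_zero (by exact_mod_cast h2.ne') hw0)
    rw [inner_smul_right, Complex.re_ofReal_mul] at h4
    exact (pos_of_mul_pos_right h4 h2.le).le
  have := ge_of_tendsto hlim hev
  rw [hw, inner_neg_right, Complex.neg_re,
    show (inner ℂ (h 0) (h 0)).re = ‖h 0‖ ^ 2 from inner_self_eq_norm_sq (𝕜 := ℂ) (h 0)] at this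
  have h5 : 0 < ‖h 0‖ ^ 2 := by positivity
  linarith

/-- The one-variable function `ζ ↦ ⟨h (ζ u), u⟩ / ζ`, of positive real part. -/
theorem exists_slice (hh : MemNA A h) (hA : 0 < lowerIndex A) {u : Cn n} (hu : ‖u‖ = 1) :
    ∃ p : ℂ → ℂ, DifferentiableOn ℂ p (ball 0 1) ∧ (∀ ζ ∈ ball (0 : ℂ) 1, 0 < (p ζ).re) ∧
      p 0 = inner ℂ u (A u) ∧ ∀ ζ, inner ℂ u (h (ζ • u)) = ζ * p ζ := by
  set q : ℂ → ℂ := fun ζ => inner ℂ u (h (ζ • u)) with hq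
  have hmem : ∀ ζ ∈ ball (0 : ℂ) 1, ζ • u ∈ unitBall n := fun ζ hζ => by
    simpa [norm_smul, hu] using hζ
  have hq0 : q 0 = 0 := by simp [hq, hh.apply_zero]
  have hqd : ∀ ζ ∈ ball (0 : ℂ) 1,
      HasDerivAt q (inner ℂ u (fderiv ℂ h (ζ • u) u)) ζ := by
    intro ζ hζ
    have h1 := (hh.holo.differentiableAt (isOpen_ball.mem_nhds (hmem ζ hζ))).hasFDerivAt
    have h2 : HasDerivAt (fun ζ : ℂ => ζ • u) u ζ := by
      simpa using (hasDerivAt_id ζ).smul_const u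
    exact (innerSL ℂ u).hasFDerivAt.comp_hasDerivAt ζ (h1.comp_hasDerivAt ζ h2)
  have hmul : ∀ ζ, q ζ = ζ * dslope q 0 ζ := by
    intro ζ
    have := sub_smul_dslope q 0 ζ
    simp only [sub_zero, hq0, smul_eq_mul] at this
    exact this.symm
  have hp0 : dslope q 0 0 = inner ℂ u (A u) := by
    rw [dslope_same, (hqd 0 (mem_ball_self one_pos)).deriv, zero_smul, hh.deriv_zero]
  refine ⟨dslope q 0, ?_, ?_, hp0, hmul⟩
  · rw [Complex.differentiableOn_dslope (ball_mem_nhds _ one_pos)]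
    exact fun ζ hζ => (hqd ζ hζ).differentiableAt.differentiableWithinAt
  · intro ζ hζ
    rcases eq_or_ne ζ 0 with rfl | hne
    · rw [hp0, ← inner_conj_symm, Complex.conj_re]
      exact hA.trans_le (lowerIndex_le A hu)
    · have hu0 : u ≠ 0 := by rintro rfl; simp at hu
      have h1 := hh.re_pos _ (hmem ζ hζ) (smul_ne_zero hne hu0)
      rw [← inner_conj_symm, Complex.conj_re, inner_smul_left,
        show inner ℂ u (h (ζ • u)) = ζ * dslope q 0 ζ from hmul ζ, ← mul_assoc,
        Complex.conj_mul', ← Complex.ofReal_pow, Complex.re_ofReal_mul] at h1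
      exact pos_of_mul_pos_right h1 (by positivity)

theorem exists_slice_apply (hh : MemNA A h) (hA : 0 < lowerIndex A) {z : Cn n} (hz : z ≠ 0) :
    ∃ u : Cn n, ‖u‖ = 1 ∧ ∃ p : ℂ → ℂ, DifferentiableOn ℂ p (ball 0 1) ∧
      (∀ ζ ∈ ball (0 : ℂ) 1, 0 < (p ζ).re) ∧ p 0 = inner ℂ u (A u) ∧
      inner ℂ z (h z) = (‖z‖ ^ 2 : ℝ) * p ‖z‖ := by
  have hz' : (‖z‖ : ℂ) ≠ 0 := by exact_mod_cast (norm_ne_zero_iff.2 hz)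
  set u : Cn n := (‖z‖ : ℂ)⁻¹ • z with hu
  have hu1 : ‖u‖ = 1 := by
    rw [hu, norm_smul, norm_inv, Complex.norm_real, norm_norm,
      inv_mul_cancel₀ (norm_ne_zero_iff.2 hz)]
  have hzu : (‖z‖ : ℂ) • u = z := by rw [hu, smul_inv_smul₀ hz']
  obtain ⟨p, h1, h2, h3, h4⟩ := hh.exists_slice hA hu1
  refine ⟨u, hu1, p, h1, h2, h3, ?_⟩
  have h5 := h4 ‖z‖
  rw [hzu] at h5
  conv_lhs => rw [← hzu, inner_smul_left, hzu, h5]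
  push_cast
  simp
  ring

/-- This is the inward-pointing estimate behind exponential decay. On the complex line through `z`
the slice function has real part at least `m(A)` at `0`, and a Harnack-type bound carries this to
radius `r`, with a rate that does not depend on the generator. -/
theorem le_re_inner (hh : MemNA A h) (hA : 0 < lowerIndex A) {z : Cn n} {r : ℝ} (hr : r < 1)
    (hz : ‖z‖ ≤ r) : (1 - r ^ 2) / 4 * lowerIndex A * ‖z‖ ^ 2 ≤ (inner ℂ z (h z)).re := by
  rcases eq_or_ne z 0 with rfl | hne
  · simp
  obtain ⟨u, hu, p, h1, h2, h3, h4⟩ := hh.exists_slice_apply hA hne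
  have h5 := le_re_of_re_pos h1 h2 (ζ := ‖z‖) hr (by simpa using hz)
  have h6 := lowerIndex_le A hu
  rw [← inner_conj_symm, Complex.conj_re, ← h3] at h6
  have hr0 : 0 ≤ r := (norm_nonneg _).trans hz
  have h7 : 0 ≤ 1 - r ^ 2 := by nlinarith
  rw [h4, Complex.re_ofReal_mul, mul_comm]
  gcongr
  refine le_trans ?_ h5
  gcongr

theorem norm_inner_le (hh : MemNA A h) (hA : 0 < lowerIndex A) {z : Cn n} {r : ℝ} (hr : r < 1)
    (hz : ‖z‖ ≤ r) : ‖inner ℂ z (h z)‖ ≤ ‖A‖ * (1 + r) / (1 - r) := by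
  have hr0 : 0 ≤ r := (norm_nonneg _).trans hz
  have h1r : 0 < 1 - r := by linarith
  rcases eq_or_ne z 0 with rfl | hne
  · simp only [inner_zero_left, norm_zero]; positivity
  obtain ⟨u, hu, p, h1, h2, h3, h4⟩ := hh.exists_slice_apply hA hne
  have h5 := norm_le_of_re_pos h1 h2 (ζ := ‖z‖) hr (by simpa using hz)
  have h6 : ‖p 0‖ ≤ ‖A‖ := by
    have := norm_inner_le_norm (𝕜 := ℂ) u (A u)
    have h7 := A.le_opNorm u
    rw [hu] at this h7
    rw [h3]; linarith
  rw [h4, norm_mul, Complex.norm_real, Real.norm_of_nonneg (by positivity)]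
  have h8 : ‖z‖ ^ 2 ≤ 1 := by
    have := norm_nonneg z
    nlinarith
  calc ‖z‖ ^ 2 * ‖p ‖z‖‖ ≤ 1 * (‖p 0‖ * (1 + r) / (1 - r)) := by gcongr
    _ ≤ ‖A‖ * (1 + r) / (1 - r) := by rw [one_mul]; gcongr

/-- The bound on a generator on a smaller ball, depending only on `‖A‖` and the radius. -/
theorem norm_le (hh : MemNA A h) (hA : 0 < lowerIndex A) {z : Cn n} {r : ℝ} (hr : r < 1)
    (hz : ‖z‖ ≤ r) : ‖h z‖ ≤ 8 * ‖A‖ / (1 - r) ^ 2 := by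
  have hr0 : 0 ≤ r := (norm_nonneg _).trans hz
  have h1r : 0 < 1 - r := by linarith
  rcases eq_or_ne (h z) 0 with h0 | hne
  · rw [h0, norm_zero]; positivity
  set ρ := (1 - r) / 2 with hρ
  have hρ0 : 0 < ρ := by positivity
  have hne' : ‖h z‖ ≠ 0 := norm_ne_zero_iff.2 hne
  set w : Cn n := (‖h z‖ : ℂ)⁻¹ • h z with hw
  have hw1 : ‖w‖ = 1 := by
    rw [hw, norm_smul, norm_inv, Complex.norm_real, norm_norm, inv_mul_cancel₀ hne']
  have hwh : ‖inner ℂ w (h z)‖ = ‖h z‖ := by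
    rw [hw, inner_smul_left, norm_mul, inner_self_eq_norm_sq_to_K]
    simp
    field_simp
  have hb : ∀ ζ ∈ closedBall (0 : ℂ) ρ, ‖z + ζ • w‖ ≤ r + ρ := by
    intro ζ hζ
    rw [mem_closedBall_zero_iff] at hζ
    have := norm_add_le z (ζ • w)
    rw [norm_smul, hw1, mul_one] at this
    linarith
  have hrρ : r + ρ < 1 := by rw [hρ]; linarith
  have hd : ∀ ζ ∈ closedBall (0 : ℂ) ρ, DifferentiableAt ℂ (fun ζ : ℂ => h (z + ζ • w)) ζ := by
    intro ζ hζ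
    have h1 := hh.holo.differentiableAt (x := z + ζ • w) (isOpen_ball.mem_nhds
      (by rw [mem_ball_zero_iff]; linarith [hb ζ hζ]))
    exact h1.comp (f := fun ζ : ℂ => z + ζ • w) ζ (by fun_prop)
  -- Only `⟨z, h z⟩` is controlled so far, not the other components of `h z`. On `‖ζ‖ = ρ` this
  -- function equals `ζ⟨z + ζw, h(z + ζw)⟩`, because `ρ² = ζ ζ̄` and the inner product is
  -- conjugate-linear in its first slot. At `ζ = 0` its modulus is `ρ²‖h z‖`, so the maximum
  -- principle applies.
  have key := Complex.norm_le_of_forall_mem_frontier_norm_le (U := ball (0 : ℂ) ρ)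
    (f := fun ζ => ζ * inner ℂ z (h (z + ζ • w)) + (ρ ^ 2 : ℝ) * inner ℂ w (h (z + ζ • w)))
    (C := ρ * (‖A‖ * (1 + (r + ρ)) / (1 - (r + ρ)))) isBounded_ball ?_ ?_ (z := 0)
    (subset_closure (mem_ball_self hρ0))
  · simp only [zero_smul, add_zero, zero_mul, zero_add, norm_mul, Complex.norm_real, hwh,
      Real.norm_of_nonneg (sq_nonneg ρ)] at key
    have e : 1 - (r + ρ) = ρ := by rw [hρ]; ring
    rw [e] at key
    have e2 : ρ * (‖A‖ * (1 + (r + ρ)) / ρ) = ‖A‖ * (1 + (r + ρ)) := by field_simp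
    rw [e2] at key
    have e3 : (1 - r) ^ 2 = 4 * ρ ^ 2 := by rw [hρ]; ring
    rw [e3, le_div_iff₀ (by positivity)]
    have : ‖A‖ * (1 + (r + ρ)) ≤ ‖A‖ * 2 := by gcongr; linarith
    linarith
  · apply DifferentiableOn.diffContOnCl
    rw [closure_ball _ hρ0.ne']
    intro ζ hζ
    have h1 := hd ζ hζ
    have h2 : DifferentiableAt ℂ (fun ζ : ℂ => inner ℂ z (h (z + ζ • w))) ζ :=
      (innerSL ℂ z).differentiableAt.comp ζ h1
    have h3 : DifferentiableAt ℂ (fun ζ : ℂ => inner ℂ w (h (z + ζ • w))) ζ :=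
      (innerSL ℂ w).differentiableAt.comp ζ h1
    exact ((differentiableAt_id.mul h2).add (h3.const_mul _)).differentiableWithinAt
  · intro ζ hζ
    rw [frontier_ball _ hρ0.ne', mem_sphere_zero_iff_norm] at hζ
    have e : ((ρ ^ 2 : ℝ) : ℂ) = ζ * (starRingEnd ℂ) ζ := by
      rw [Complex.mul_conj', hζ]; push_cast; rfl
    have e2 : ζ * inner ℂ z (h (z + ζ • w)) + (ρ ^ 2 : ℝ) * inner ℂ w (h (z + ζ • w))
        = ζ * inner ℂ (z + ζ • w) (h (z + ζ • w)) := by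
      rw [e, inner_add_left, inner_smul_left w _ ζ]; ring
    rw [e2, norm_mul, hζ]
    gcongr
    exact hh.norm_inner_le hA hrρ (hb ζ (by simp [hζ]))

end MemNA

end LoewnerPDE

/-! ### Carathéodory differential equations and the radial retraction -/

namespace LoewnerPDE

open Filter Topology
open scoped BoundedContinuousFunction

section Caratheodory

variable {E : Type*} [NormedAddCommGroup E]

/-- Superposition of a Carathéodory function with a continuous curve is measurable. -/
theorem aestronglyMeasurable_comp_curve {g : E → ℝ → E}
    (hmeas : ∀ x, AEStronglyMeasurable (g x) volume) (hcont : ∀ t, Continuous fun x => g x t)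
    {u : ℝ → E} (hu : Continuous u) : AEStronglyMeasurable (fun t => g (u t) t) volume := by
  -- The curve is sampled at grid points of mesh `1/(N+1)`; each sampled superposition is measurable
  -- on countably many pieces.
  refine aestronglyMeasurable_of_tendsto_ae atTop
    (f := fun (N : ℕ) t => g (u ((⌊((N : ℝ) + 1) * t⌋ : ℝ) / (N + 1))) t) (fun N => ?_)
    (Eventually.of_forall fun t => ?_)
  · have hcover : (⋃ k : ℤ, {t : ℝ | ⌊((N : ℝ) + 1) * t⌋ = k}) = univ := by
      ext t; simp
    rw [← Measure.restrict_univ (μ := (volume : Measure ℝ)), ← hcover,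
      aestronglyMeasurable_iUnion_iff]
    intro k
    have hset : MeasurableSet {t : ℝ | ⌊((N : ℝ) + 1) * t⌋ = k} :=
      (Int.measurable_floor.comp (measurable_const_mul _)) (measurableSet_singleton k)
    refine ((hmeas (u ((k : ℝ) / (N + 1)))).mono_measure Measure.restrict_le_self).congr ?_
    filter_upwards [ae_restrict_mem hset] with t ht
    have ht : ⌊((N : ℝ) + 1) * t⌋ = k := ht
    simp only [ht]
  · have h1 : Tendsto (fun N : ℕ => (⌊((N : ℝ) + 1) * t⌋ : ℝ) / (N + 1)) atTop (𝓝 t) := by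
      have h2 : Tendsto (fun N : ℕ => t - 1 / ((N : ℝ) + 1)) atTop (𝓝 t) := by
        simpa using tendsto_const_nhds.sub (tendsto_one_div_add_atTop_nhds_zero_nat (𝕜 := ℝ))
      refine tendsto_of_tendsto_of_tendsto_of_le_of_le h2 tendsto_const_nhds
        (fun N => ?_) (fun N => ?_)
      · have hN : (0 : ℝ) < N + 1 := by positivity
        show t - 1 / ((N : ℝ) + 1) ≤ _
        rw [le_div_iff₀ hN, sub_mul, one_div, inv_mul_cancel₀ hN.ne']
        linarith [Int.sub_one_lt_floor (((N : ℝ) + 1) * t)]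
      · have hN : (0 : ℝ) < N + 1 := by positivity
        show _ ≤ t
        rw [div_le_iff₀ hN]
        linarith [Int.floor_le (((N : ℝ) + 1) * t)]
    exact ((hcont t).tendsto _).comp ((hu.tendsto t).comp h1)

theorem intervalIntegrable_comp_curve {g : E → ℝ → E} {M : ℝ}
    (hmeas : ∀ x, AEStronglyMeasurable (g x) volume) (hcont : ∀ t, Continuous fun x => g x t)
    (hbd : ∀ x t, ‖g x t‖ ≤ M) {u : ℝ → E} (hu : Continuous u) (a b : ℝ) :
    IntervalIntegrable (fun t => g (u t) t) volume a b := by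
  refine (intervalIntegrable_const (c := M)).mono_fun
    (aestronglyMeasurable_comp_curve hmeas hcont hu).restrict (Eventually.of_forall fun t => ?_)
  exact (hbd _ _).trans (le_abs_self M)

/-- Global solvability of `u' = g(u,t)` for bounded, globally Lipschitz Carathéodory `g`. -/
theorem exists_forward_solution [NormedSpace ℝ E] [CompleteSpace E] {g : E → ℝ → E} {M L : ℝ} (hL : 0 < L)
    (hmeas : ∀ x, AEStronglyMeasurable (g x) volume) (hbd : ∀ x t, ‖g x t‖ ≤ M)
    (hlip : ∀ x y t, ‖g x t - g y t‖ ≤ L * ‖x - y‖) (s : ℝ) (z : E) :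
    ∃ u : ℝ → E, Continuous u ∧ ∀ t, s ≤ t → u t = z + ∫ τ in s..t, g (u τ) τ := by
  have hcont : ∀ t, Continuous fun x => g x t := fun t =>
    (LipschitzWith.of_dist_le_mul (K := L.toNNReal) fun x y => by
      simpa [dist_eq_norm, hL.le] using hlip x y t).continuous
  have hM : 0 ≤ M := (norm_nonneg _).trans (hbd 0 0)
  -- The unknown is written `u = z + e^{2L(τ-s)} w` with `w` bounded. The weight makes the Picard
  -- map a `1/2`-contraction on the whole line at once, since `e^{-2Lx} ∫₀ˣ L e^{2Ly} dy ≤ 1/2` for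
  -- `x ≥ 0`.
  set κ : (ℝ →ᵇ E) → ℝ → E := fun w τ => z + Real.exp (2 * L * (τ - s)) • w τ with hκ
  have hκc : ∀ w, Continuous (κ w) := fun w => by
    have := w.continuous
    simp only [hκ]; fun_prop
  have hint : ∀ w a b, IntervalIntegrable (fun τ => g (κ w τ) τ) volume a b := fun w =>
    intervalIntegrable_comp_curve hmeas hcont hbd (hκc w)
  -- Replacing `t` by `max t s` extends the Picard integral by zero to the left of `s`.
  set ev : (ℝ →ᵇ E) → ℝ → E := fun w t =>
    Real.exp (-(2 * L * (max t s - s))) • ∫ τ in s..max t s, g (κ w τ) τ with hev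
  have hevc : ∀ w, Continuous (ev w) := fun w => by
    have h1 : Continuous fun t => ∫ τ in s..t, g (κ w τ) τ :=
      intervalIntegral.continuous_primitive (hint w) s
    have h2 : Continuous fun t : ℝ => max t s := by fun_prop
    have h3 := h1.comp h2
    exact (by fun_prop : Continuous fun t : ℝ => Real.exp (-(2 * L * (max t s - s)))).smul h3
  have hevb : ∀ w t, ‖ev w t‖ ≤ M / (2 * L) := by
    intro w t
    have hts : s ≤ max t s := le_max_right _ _
    have h1 : ‖∫ τ in s..max t s, g (κ w τ) τ‖ ≤ M * (max t s - s) := by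
      have := intervalIntegral.norm_integral_le_of_norm_le_const (a := s) (b := max t s)
        (f := fun τ => g (κ w τ) τ) (C := M) (fun τ _ => hbd _ _)
      rwa [abs_of_nonneg (by linarith)] at this
    rw [hev]
    simp only [norm_smul, Real.norm_eq_abs, Real.abs_exp]
    rw [Real.exp_neg, inv_mul_le_iff₀ (Real.exp_pos _)]
    refine h1.trans ?_
    have h2 := Real.add_one_le_exp (2 * L * (max t s - s))
    rw [← mul_div_assoc, le_div_iff₀ (by positivity)]
    nlinarith
  let Φ : (ℝ →ᵇ E) → (ℝ →ᵇ E) := fun w =>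
    BoundedContinuousFunction.ofNormedAddCommGroup (ev w) (hevc w) _ (hevb w)
  have hΦ : ContractingWith (1 / 2) Φ := by
    refine ⟨by rw [← NNReal.coe_lt_coe]; norm_num, LipschitzWith.of_dist_le_mul fun w w' => ?_⟩
    rw [BoundedContinuousFunction.dist_le (by positivity)]
    intro t
    have hts : s ≤ max t s := le_max_right _ _
    have hprim : ∀ τ ∈ uIcc s (max t s), HasDerivAt (fun τ => Real.exp (2 * L * (τ - s)) / 2
        * ‖w - w'‖) (L * (Real.exp (2 * L * (τ - s)) * ‖w - w'‖)) τ := by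
      intro τ _
      have h1 : HasDerivAt (fun τ => 2 * L * (τ - s)) (2 * L) τ := by
        simpa using ((hasDerivAt_id τ).sub_const s).const_mul (2 * L)
      convert! (h1.exp.div_const 2).mul_const ‖w - w'‖ using 1
      ring
    have hii : IntervalIntegrable (fun τ => L * (Real.exp (2 * L * (τ - s)) * ‖w - w'‖))
        volume s (max t s) := by
      apply Continuous.intervalIntegrable; fun_prop
    have h2 : ‖∫ τ in s..max t s, (g (κ w τ) τ - g (κ w' τ) τ)‖
        ≤ ∫ τ in s..max t s, L * (Real.exp (2 * L * (τ - s)) * ‖w - w'‖) := by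
      refine intervalIntegral.norm_integral_le_of_norm_le hts
        (Eventually.of_forall fun τ _ => ?_) hii
      refine (hlip _ _ _).trans ?_
      gcongr
      simp only [hκ, add_sub_add_left_eq_sub, ← smul_sub, norm_smul, Real.norm_eq_abs,
        Real.abs_exp]
      gcongr
      exact (w - w').norm_coe_le_norm τ
    rw [intervalIntegral.integral_eq_sub_of_hasDerivAt hprim hii] at h2
    show dist (ev w t) (ev w' t) ≤ _
    rw [hev]
    simp only
    rw [dist_eq_norm, ← smul_sub, ← intervalIntegral.integral_sub (hint w _ _) (hint w' _ _),
      norm_smul, Real.norm_eq_abs, Real.abs_exp, Real.exp_neg, inv_mul_le_iff₀ (Real.exp_pos _),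
      dist_eq_norm]
    refine h2.trans ?_
    have := norm_nonneg (w - w')
    simp
    nlinarith
  set w := hΦ.fixedPoint Φ with hw
  have hfix : Φ w = w := hΦ.fixedPoint_isFixedPt
  refine ⟨κ w, hκc w, fun t ht => ?_⟩
  have h1 : w t = ev w t := by
    conv_lhs => rw [← hfix]
    rfl
  have h2 : κ w t = z + Real.exp (2 * L * (t - s)) • ev w t := by rw [hκ]; simp only [h1]
  rw [h2, hev]
  simp only [max_eq_left ht, smul_smul, ← Real.exp_add, add_neg_cancel, Real.exp_zero, one_smul]

end Caratheodory

/-- The radial retraction of a normed space onto the closed ball of radius `R`. -/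
noncomputable def radialRetraction {n : ℕ} (R : ℝ) (x : Cn n) : Cn n :=
  (((R / max R ‖x‖ : ℝ) : ℂ)) • x

section Retraction

variable {n : ℕ} {R : ℝ}

theorem radialRetraction_of_le (hR : 0 < R) {x : Cn n} (hx : ‖x‖ ≤ R) :
    radialRetraction R x = x := by
  rw [radialRetraction, max_eq_left hx, div_self hR.ne']; simp

theorem norm_radialRetraction_le (hR : 0 < R) (x : Cn n) : ‖radialRetraction R x‖ ≤ R := by
  have : 0 < max R ‖x‖ := lt_max_of_lt_left hR
  rw [radialRetraction, norm_smul, Complex.norm_real, Real.norm_of_nonneg (by positivity),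
    div_mul_eq_mul_div, div_le_iff₀ this]
  gcongr
  exact le_max_right _ _

theorem norm_radialRetraction_sub_le (hR : 0 < R) (x y : Cn n) :
    ‖radialRetraction R x - radialRetraction R y‖ ≤ 2 * ‖x - y‖ := by
  have hx : 0 < max R ‖x‖ := lt_max_of_lt_left hR
  have hy : 0 < max R ‖y‖ := lt_max_of_lt_left hR
  set a := R / max R ‖x‖ with ha
  set b := R / max R ‖y‖ with hb
  have e : radialRetraction R x - radialRetraction R y
      = (a : ℂ) • (x - y) + ((a - b : ℝ) : ℂ) • y := by
    simp only [radialRetraction, ← ha, ← hb]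
    push_cast
    module
  have ha0 : 0 ≤ a := by positivity
  have ha1 : a ≤ 1 := by rw [ha, div_le_one hx]; exact le_max_left _ _
  have h1 : |max R ‖y‖ - max R ‖x‖| ≤ ‖x - y‖ := by
    have h := abs_max_sub_max_le_max R ‖y‖ R ‖x‖
    rw [sub_self, abs_zero, max_eq_right (abs_nonneg (‖y‖ - ‖x‖))] at h
    rw [norm_sub_rev]
    exact h.trans (abs_norm_sub_norm_le y x)
  have h2 : |a - b| * ‖y‖ ≤ ‖x - y‖ := by
    have e2 : a - b = a * ((max R ‖y‖ - max R ‖x‖) / max R ‖y‖) := by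
      rw [ha, hb]; field_simp
    rw [e2, abs_mul, abs_of_nonneg ha0, abs_div, abs_of_pos hy]
    calc a * (|max R ‖y‖ - max R ‖x‖| / max R ‖y‖) * ‖y‖
        ≤ 1 * (‖x - y‖ / max R ‖y‖) * max R ‖y‖ := by
          gcongr
          exact le_max_right _ _
      _ = ‖x - y‖ := by field_simp
  rw [e]
  refine (norm_add_le _ _).trans ?_
  rw [norm_smul, norm_smul, Complex.norm_real, Complex.norm_real, Real.norm_of_nonneg ha0,
    Real.norm_eq_abs]
  nlinarith [norm_nonneg (x - y)]

end Retraction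

end LoewnerPDE

/-! ### Integral curves: decay and two-sided Gronwall estimates -/

namespace LoewnerPDE

open Filter Topology

variable {n : ℕ}

/-- `u` is an (absolutely continuous) solution of `u' = g(u,t)` on `[s,∞)`. -/
structure IsForwardCurve (g : Cn n → ℝ → Cn n) (s : ℝ) (u : ℝ → Cn n) : Prop where
  intble : ∀ a b, s ≤ a → a ≤ b → IntervalIntegrable (fun τ => g (u τ) τ) volume a b
  incr : ∀ a b, s ≤ a → a ≤ b → u b - u a = ∫ τ in a..b, g (u τ) τ

namespace IsForwardCurve

variable {g : Cn n → ℝ → Cn n} {s M L : ℝ} {u u' : ℝ → Cn n}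

theorem mono (hu : IsForwardCurve g s u) {t : ℝ} (ht : s ≤ t) : IsForwardCurve g t u :=
  ⟨fun a b h1 h2 => hu.intble a b (ht.trans h1) h2, fun a b h1 h2 => hu.incr a b (ht.trans h1) h2⟩

theorem norm_sub_le (hu : IsForwardCurve g s u) (hM : ∀ τ, s ≤ τ → ‖g (u τ) τ‖ ≤ M) {a b : ℝ}
    (ha : s ≤ a) (hab : a ≤ b) : ‖u b - u a‖ ≤ M * (b - a) := by
  rw [hu.incr a b ha hab]
  have := intervalIntegral.norm_integral_le_of_norm_le_const (a := a) (b := b)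
    (f := fun τ => g (u τ) τ) (C := M) (fun τ hτ => hM τ (by
      rw [uIoc_of_le hab] at hτ; linarith [hτ.1]))
  rwa [abs_of_nonneg (by linarith)] at this

/-- Exponential decay of a curve pointing inwards. -/
theorem exp_mul_norm_sq_le (hu : IsForwardCurve g s u) (hM : ∀ τ, s ≤ τ → ‖g (u τ) τ‖ ≤ M)
    (hL0 : 0 ≤ L)
    (hL : ∀ a τ, s ≤ a → a ≤ τ → ‖g (u τ) τ - g (u a) τ‖ ≤ L * ‖u τ - u a‖) {c : ℝ} (hc : 0 ≤ c)
    (hin : ∀ a τ, s ≤ a → a ≤ τ → (inner ℂ (u a) (g (u a) τ)).re ≤ -c * ‖u a‖ ^ 2) {t : ℝ}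
    (ht : s ≤ t) : Real.exp (2 * c * t) * ‖u t‖ ^ 2 ≤ Real.exp (2 * c * s) * ‖u s‖ ^ 2 := by
  have hM0 : 0 ≤ M := (norm_nonneg _).trans (hM s le_rfl)
  set B := ‖u s‖ + M * (t - s) with hB
  have hB0 : 0 ≤ B := by
    have : 0 ≤ t - s := by linarith
    positivity
  refine le_of_increment_le_sq (φ := fun t => Real.exp (2 * c * t) * ‖u t‖ ^ 2)
    (C := Real.exp (2 * c * t) * (2 * (B * (L * M)) + M ^ 2)) ht ?_
  intro a b ha hab hbt
  have hk : 0 ≤ b - a := by linarith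
  have huB : ‖u a‖ ≤ B := by
    have h1 := hu.norm_sub_le hM le_rfl ha
    have h2 := norm_sub_norm_le (u a) (u s)
    have h3 : M * (a - s) ≤ M * (t - s) := by gcongr; linarith
    linarith
  have hD := hu.norm_sub_le hM ha hab
  set D := u b - u a with hDdef
  let ℓ : Cn n →L[ℝ] ℝ := Complex.reCLM ∘L (innerSL ℂ (u a)).restrictScalars ℝ
  have hℓ : ∀ x, ℓ x = (inner ℂ (u a) x).re := fun x => rfl
  have hint := hu.intble a b ha hab
  have hinner : (inner ℂ (u a) D).re ≤ (b - a) * (-c * ‖u a‖ ^ 2 + B * (L * (M * (b - a)))) := by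
    rw [← hℓ, hDdef, hu.incr a b ha hab, ← ℓ.intervalIntegral_comp_comm hint, ← smul_eq_mul,
      ← intervalIntegral.integral_const]
    refine intervalIntegral.integral_mono_on hab ⟨ℓ.integrable_comp hint.1,
      ℓ.integrable_comp hint.2⟩ intervalIntegrable_const (fun τ hτ => ?_)
    rw [hℓ, show g (u τ) τ = g (u a) τ + (g (u τ) τ - g (u a) τ) by abel, inner_add_right,
      Complex.add_re]
    refine add_le_add (hin a τ ha hτ.1) ?_
    refine (Complex.re_le_norm _).trans ((norm_inner_le_norm _ _).trans ?_)
    have h1 := hL a τ ha hτ.1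
    have h2 := hu.norm_sub_le hM ha hτ.1
    have h3 : M * (τ - a) ≤ M * (b - a) := by gcongr; exact hτ.2
    have h4 : L * ‖u τ - u a‖ ≤ L * (M * (b - a)) := by gcongr; exact h2.trans h3
    gcongr
    exact h1.trans h4
  -- Expand `‖u a + D‖²`: the cross term supplies the decay, and the variation of `u` on `[a,b]` and
  -- `‖D‖²` are quadratic errors.
  have hexp : ‖u b‖ ^ 2 ≤ (1 - 2 * c * (b - a)) * ‖u a‖ ^ 2
      + (2 * (B * (L * M)) + M ^ 2) * (b - a) ^ 2 := by
    have h1 := norm_add_sq (𝕜 := ℂ) (u a) D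
    rw [show u a + D = u b by rw [hDdef]; abel] at h1
    rw [h1]
    have h2 : ‖D‖ ^ 2 ≤ (M * (b - a)) ^ 2 := by gcongr
    have h3 : (RCLike.re (inner ℂ (u a) D) : ℝ) = (inner ℂ (u a) D).re := rfl
    rw [h3]
    nlinarith
  have hsplit : Real.exp (2 * c * b) = Real.exp (2 * c * a) * Real.exp (2 * c * (b - a)) := by
    rw [← Real.exp_add]; ring_nf
  have h5 : Real.exp (2 * c * (b - a)) * (1 - 2 * c * (b - a)) ≤ 1 := by
    have h6 := Real.one_sub_le_exp_neg (2 * c * (b - a))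
    calc _ ≤ Real.exp (2 * c * (b - a)) * Real.exp (-(2 * c * (b - a))) := by gcongr
      _ = 1 := by rw [← Real.exp_add]; simp
  have h7 : Real.exp (2 * c * b) * ((1 - 2 * c * (b - a)) * ‖u a‖ ^ 2)
      ≤ Real.exp (2 * c * a) * ‖u a‖ ^ 2 := by
    rw [hsplit]
    calc _ = Real.exp (2 * c * a) * ‖u a‖ ^ 2 *
          (Real.exp (2 * c * (b - a)) * (1 - 2 * c * (b - a))) := by ring
      _ ≤ Real.exp (2 * c * a) * ‖u a‖ ^ 2 * 1 := by gcongr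
      _ = _ := by ring
  have h8 : Real.exp (2 * c * b) * ((2 * (B * (L * M)) + M ^ 2) * (b - a) ^ 2)
      ≤ Real.exp (2 * c * t) * ((2 * (B * (L * M)) + M ^ 2) * (b - a) ^ 2) := by
    gcongr
  have h9 := mul_le_mul_of_nonneg_left hexp (Real.exp_pos (2 * c * b)).le
  linarith

section TwoCurves

variable (hu : IsForwardCurve g s u) (hu' : IsForwardCurve g s u')
  (hM : ∀ τ, s ≤ τ → ‖g (u τ) τ‖ ≤ M) (hM' : ∀ τ, s ≤ τ → ‖g (u' τ) τ‖ ≤ M) (hL0 : 0 ≤ L)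
  (hL : ∀ τ, s ≤ τ → ‖g (u τ) τ - g (u' τ) τ‖ ≤ L * ‖u τ - u' τ‖)

include hu hu' hM hM' hL0 hL

/-- The reference point `x` is left free: the left endpoint serves the forward Gronwall estimate,
the right endpoint the backward one. -/
theorem norm_increment_sub_le {a b x : ℝ} (ha : s ≤ a) (hab : a ≤ b) (hx : x ∈ Icc a b) :
    ‖(u b - u' b) - (u a - u' a)‖ ≤ L * (‖u x - u' x‖ + 2 * M * (b - a)) * (b - a) := by
  have hM0 : 0 ≤ M := (norm_nonneg _).trans (hM s le_rfl)
  have e : (u b - u' b) - (u a - u' a) = ∫ τ in a..b, (g (u τ) τ - g (u' τ) τ) := by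
    rw [intervalIntegral.integral_sub (hu.intble a b ha hab) (hu'.intble a b ha hab),
      ← hu.incr a b ha hab, ← hu'.incr a b ha hab]
    abel
  have hlip : ∀ {w : ℝ → Cn n}, IsForwardCurve g s w → (∀ τ, s ≤ τ → ‖g (w τ) τ‖ ≤ M) →
      ∀ τ ∈ Icc a b, ‖w τ - w x‖ ≤ M * (b - a) := by
    intro w hw hwM τ hτ
    rcases le_total x τ with h | h
    · refine (hw.norm_sub_le hwM (ha.trans hx.1) h).trans ?_
      gcongr <;> linarith [hx.1, hτ.2]
    · rw [norm_sub_rev]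
      refine (hw.norm_sub_le hwM (ha.trans hτ.1) h).trans ?_
      gcongr <;> linarith [hx.2, hτ.1]
  rw [e]
  have := intervalIntegral.norm_integral_le_of_norm_le_const (a := a) (b := b)
    (f := fun τ => g (u τ) τ - g (u' τ) τ) (C := L * (‖u x - u' x‖ + 2 * M * (b - a)))
    (fun τ hτ => by
      rw [uIoc_of_le hab] at hτ
      have hτ' := Ioc_subset_Icc_self hτ
      refine (hL τ (ha.trans hτ'.1)).trans ?_
      gcongr
      have h1 := hlip hu hM τ hτ'
      have h2 := hlip hu' hM' τ hτ'
      have h3 : u τ - u' τ = (u x - u' x) + ((u τ - u x) - (u' τ - u' x)) := by abel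
      have h4 := norm_add_le (u x - u' x) ((u τ - u x) - (u' τ - u' x))
      have h5 := _root_.norm_sub_le (u τ - u x) (u' τ - u' x)
      rw [← h3] at h4
      linarith)
  rwa [abs_of_nonneg (by linarith)] at this

theorem norm_sub_le_exp_mul {t : ℝ} (ht : s ≤ t) :
    ‖u t - u' t‖ ≤ Real.exp (L * (t - s)) * ‖u s - u' s‖ := by
  have hM0 : 0 ≤ M := (norm_nonneg _).trans (hM s le_rfl)
  have key := le_of_increment_le_sq (φ := fun x => Real.exp (-(L * x)) * ‖u x - u' x‖)
    (C := Real.exp (-(L * s)) * (L * (2 * M))) ht (fun a b ha hab hb => by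
      have h1 := norm_increment_sub_le hu hu' hM hM' hL0 hL ha hab (left_mem_Icc.2 hab)
      have h2 := norm_sub_norm_le (u b - u' b) (u a - u' a)
      have h3 : ‖u b - u' b‖ ≤ ‖u a - u' a‖ * (1 + L * (b - a)) + L * (2 * M) * (b - a) ^ 2 := by
        nlinarith
      have h4 : Real.exp (-(L * b)) * (1 + L * (b - a)) ≤ Real.exp (-(L * a)) := by
        have h5 := Real.add_one_le_exp (L * (b - a))
        calc _ ≤ Real.exp (-(L * b)) * Real.exp (L * (b - a)) := by gcongr; linarith
          _ = _ := by rw [← Real.exp_add]; ring_nf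
      have h6 : Real.exp (-(L * b)) ≤ Real.exp (-(L * s)) := by
        gcongr; exact ha.trans hab
      have h7 : Real.exp (-(L * b)) * (L * (2 * M) * (b - a) ^ 2)
          ≤ Real.exp (-(L * s)) * (L * (2 * M) * (b - a) ^ 2) := by gcongr
      have h8 := mul_le_mul_of_nonneg_left h3 (Real.exp_pos (-(L * b))).le
      have h9 := mul_le_mul_of_nonneg_right h4 (norm_nonneg (u a - u' a))
      nlinarith)
  have e : Real.exp (L * (t - s)) = Real.exp (L * t) * Real.exp (-(L * s)) := by
    rw [← Real.exp_add]; ring_nf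
  rw [e, mul_assoc, ← inv_mul_le_iff₀ (Real.exp_pos _), ← Real.exp_neg]
  exact key

/-- Gronwall run backwards in time. It makes the evolution maps injective with Lipschitz inverse. -/
theorem norm_sub_le_exp_mul' {t : ℝ} (ht : s ≤ t) :
    ‖u s - u' s‖ ≤ Real.exp (L * (t - s)) * ‖u t - u' t‖ := by
  have hM0 : 0 ≤ M := (norm_nonneg _).trans (hM s le_rfl)
  have key := le_of_increment_le_sq (φ := fun x => -(Real.exp (L * x) * ‖u x - u' x‖))
    (C := Real.exp (L * t) * (L * (2 * M))) ht (fun a b ha hab hb => by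
      have h1 := norm_increment_sub_le hu hu' hM hM' hL0 hL ha hab (right_mem_Icc.2 hab)
      have h2 := norm_sub_norm_le (u a - u' a) (u b - u' b)
      rw [norm_sub_rev (u a - u' a)] at h2
      have h3 : ‖u a - u' a‖ ≤ ‖u b - u' b‖ * (1 + L * (b - a)) + L * (2 * M) * (b - a) ^ 2 := by
        nlinarith
      have h4 : Real.exp (L * a) * (1 + L * (b - a)) ≤ Real.exp (L * b) := by
        have h5 := Real.add_one_le_exp (L * (b - a))
        calc _ ≤ Real.exp (L * a) * Real.exp (L * (b - a)) := by gcongr; linarith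
          _ = _ := by rw [← Real.exp_add]; ring_nf
      have h6 : Real.exp (L * a) ≤ Real.exp (L * t) := by
        gcongr; exact hab.trans hb
      have h7 : Real.exp (L * a) * (L * (2 * M) * (b - a) ^ 2)
          ≤ Real.exp (L * t) * (L * (2 * M) * (b - a) ^ 2) := by gcongr
      have h8 := mul_le_mul_of_nonneg_left h3 (Real.exp_pos (L * a)).le
      have h9 := mul_le_mul_of_nonneg_right h4 (norm_nonneg (u b - u' b))
      nlinarith)
  simp only [neg_le_neg_iff] at key
  have e : Real.exp (L * (t - s)) = Real.exp (-(L * s)) * Real.exp (L * t) := by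
    rw [← Real.exp_add]; ring_nf
  rw [e, mul_assoc, Real.exp_neg, le_inv_mul_iff₀ (Real.exp_pos _)]
  exact key

end TwoCurves

end IsForwardCurve

end LoewnerPDE

/-! ### The evolution family -/

namespace LoewnerPDE

open Filter Topology

variable {n : ℕ} {A : Cn n →L[ℂ] Cn n} {h : Cn n → ℝ → Cn n}

/-- Bounds for a generator on a smaller ball, uniform in time. -/
theorem MemHA.exists_bounds (hh : MemHA A h) (hA : 0 < lowerIndex A) {r : ℝ} (hr0 : 0 ≤ r)
    (hr : r < 1) : ∃ M L : ℝ, 0 < M ∧ 0 < L ∧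
      (∀ t, 0 ≤ t → ∀ x, ‖x‖ ≤ r → ‖h x t‖ ≤ M) ∧
      (∀ t, 0 ≤ t → ∀ x y, ‖x‖ ≤ r → ‖y‖ ≤ r → ‖h y t - h x t‖ ≤ L * ‖y - x‖) ∧
      (∀ t, 0 ≤ t → ∀ x, ‖x‖ ≤ r → ‖h x t - A x‖ ≤ L * ‖x‖ ^ 2) := by
  set R := (1 + r) / 2 with hR
  have hrR : r < R := by rw [hR]; linarith
  have hR1 : R < 1 := by rw [hR]; linarith
  set M := 8 * ‖A‖ / (1 - R) ^ 2 with hM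
  have hM0 : 0 ≤ M := by positivity
  have hRr : 0 < R - r := by linarith
  have hb : ∀ t, 0 ≤ t → ∀ y ∈ ball (0 : Cn n) R, ‖h y t‖ ≤ M := fun t ht y hy =>
    (hh.memNA t ht).norm_le hA hR1 (by rw [mem_ball_zero_iff] at hy; exact hy.le)
  have hd : ∀ t, 0 ≤ t → DifferentiableOn ℂ (fun z => h z t) (ball 0 R) := fun t ht =>
    (hh.memNA t ht).holo.mono (ball_subset_ball hR1.le)
  have h1 : 0 ≤ 2 * M / (R - r) := by positivity
  have h2 : 0 ≤ 16 * M / (R - r) ^ 2 := by positivity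
  refine ⟨M + 1, 2 * M / (R - r) + 16 * M / (R - r) ^ 2 + 1, by positivity, by positivity,
    fun t ht x hx => ?_, fun t ht x y hx hy => ?_, fun t ht x hx => ?_⟩
  · linarith [hb t ht x (by rw [mem_ball_zero_iff]; linarith)]
  · refine (norm_sub_le_of_bounded_ball hrR (hd t ht) (hb t ht) hx hy).trans ?_
    gcongr; linarith
  · have := norm_taylor_le_of_bounded_ball hrR (hd t ht) (hb t ht) (x := 0) (by simpa using hr0) hx
    rw [(hh.memNA t ht).apply_zero, (hh.memNA t ht).deriv_zero, sub_zero, sub_zero] at this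
    refine this.trans ?_
    gcongr; linarith

/-- Composing `-h` with a retraction onto a ball of radius `R` between `‖z‖` and `1` gives a
bounded, globally Lipschitz field, hence a global solution. That field still points inwards, so the
solution never leaves the ball of radius `‖z‖`, where the retraction is the identity. -/
theorem MemHA.exists_curve (hh : MemHA A h) (hA : 0 < lowerIndex A) {s : ℝ} (hs : 0 ≤ s)
    {z : Cn n} (hz : z ∈ unitBall n) : ∃ u : ℝ → Cn n, u s = z ∧
      IsForwardCurve (fun x t => -h x t) s u ∧ ∀ t, s ≤ t → ‖u t‖ ≤ ‖z‖ := by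
  rw [mem_ball_zero_iff] at hz
  set R := (1 + ‖z‖) / 2 with hR
  have hzR : ‖z‖ < R := by rw [hR]; linarith
  have hR1 : R < 1 := by rw [hR]; linarith
  have hR0 : 0 < R := (norm_nonneg z).trans_lt hzR
  obtain ⟨M, L, hM, hL, hbd, hlip, -⟩ := hh.exists_bounds hA hR0.le hR1
  set g : Cn n → ℝ → Cn n := fun x => (Ici (0 : ℝ)).indicator
    (fun t => -h (radialRetraction R x) t) with hg
  have hgpos : ∀ x t, 0 ≤ t → g x t = -h (radialRetraction R x) t := fun x t ht => by
    rw [hg]; simp only; rw [indicator_of_mem (mem_Ici.2 ht)]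
  have hgneg : ∀ x t, ¬ 0 ≤ t → g x t = 0 := fun x t ht => by
    rw [hg]; simp only; rw [indicator_of_notMem (by simpa using ht)]
  have hρ := fun x : Cn n => norm_radialRetraction_le hR0 x
  have hgmeas : ∀ x, AEStronglyMeasurable (g x) volume := fun x => by
    rw [hg]; simp only
    rw [aestronglyMeasurable_indicator_iff measurableSet_Ici]
    exact (hh.meas _ (by rw [mem_ball_zero_iff]; linarith [hρ x])).neg.aestronglyMeasurable
  have hgbd : ∀ x t, ‖g x t‖ ≤ M := fun x t => by
    by_cases ht : 0 ≤ t
    · rw [hgpos x t ht, norm_neg]; exact hbd t ht _ (hρ x)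
    · rw [hgneg x t ht, norm_zero]; exact hM.le
  have hglip : ∀ x y t, ‖g x t - g y t‖ ≤ L * 2 * ‖x - y‖ := fun x y t => by
    by_cases ht : 0 ≤ t
    · rw [hgpos x t ht, hgpos y t ht, neg_sub_neg, norm_sub_rev, mul_assoc]
      refine (hlip t ht _ _ (hρ y) (hρ x)).trans ?_
      gcongr
      exact norm_radialRetraction_sub_le hR0 x y
    · rw [hgneg x t ht, hgneg y t ht, sub_zero, norm_zero]; positivity
  obtain ⟨u, huc, hu⟩ := exists_forward_solution (by positivity) hgmeas hgbd hglip s z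
  have hcont : ∀ t, Continuous fun x => g x t := fun t =>
    (LipschitzWith.of_dist_le_mul (K := (L * 2).toNNReal) fun x y => by
      simpa [dist_eq_norm, hL.le] using hglip x y t).continuous
  have hint := intervalIntegrable_comp_curve hgmeas hcont hgbd huc
  have hus : u s = z := by simpa using hu s le_rfl
  have hcurve : IsForwardCurve g s u := by
    refine ⟨fun a b _ _ => hint a b, fun a b ha hab => ?_⟩
    rw [hu a ha, hu b (ha.trans hab), add_sub_add_left_eq_sub,
      intervalIntegral.integral_interval_sub_left (hint _ _) (hint _ _)]
  have hnorm : ∀ t, s ≤ t → ‖u t‖ ≤ ‖z‖ := by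
    intro t ht
    -- Rate `c = 0` suffices here: only monotonicity of the norm is needed.
    have := hcurve.exp_mul_norm_sq_le (fun τ _ => hgbd _ _) (L := L * 2) (by positivity)
      (fun a τ _ _ => hglip _ _ _) (c := 0) le_rfl (fun a τ ha hτ => ?_) ht
    · rw [hus] at this
      simp only [mul_zero, zero_mul, Real.exp_zero, one_mul] at this
      exact (sq_le_sq₀ (norm_nonneg _) (norm_nonneg _)).1 this
    · have hτ0 : 0 ≤ τ := hs.trans (ha.trans hτ)
      rw [hgpos _ _ hτ0, inner_neg_right, Complex.neg_re, neg_zero, zero_mul, neg_nonpos]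
      -- The retraction multiplies `u a` by a positive scalar, so the sign of the inner product is
      -- unaffected.
      have hpos : 0 < R / max R ‖u a‖ := div_pos hR0 (lt_max_of_lt_left hR0)
      have h1 := (hh.memNA τ hτ0).le_re_inner hA hR1 (hρ (u a))
      have h2 : 0 ≤ (inner ℂ (radialRetraction R (u a)) (h (radialRetraction R (u a)) τ)).re := by
        refine le_trans ?_ h1
        have : 0 ≤ 1 - R ^ 2 := by nlinarith
        positivity
      conv at h2 => rw [radialRetraction]
      rw [inner_smul_left, Complex.conj_ofReal, Complex.re_ofReal_mul] at h2
      exact nonneg_of_mul_nonneg_right h2 hpos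
  have hgh : ∀ τ, s ≤ τ → g (u τ) τ = -h (u τ) τ := fun τ hτ => by
    rw [hgpos _ _ (hs.trans hτ), radialRetraction_of_le hR0 ((hnorm τ hτ).trans hzR.le)]
  refine ⟨u, hus, ⟨fun a b ha hab => ?_, fun a b ha hab => ?_⟩, hnorm⟩
  · refine (hint a b).congr (fun τ hτ => ?_)
    rw [uIoc_of_le hab] at hτ
    exact hgh τ (ha.trans hτ.1.le)
  · rw [hcurve.incr a b ha hab]
    refine intervalIntegral.integral_congr (fun τ hτ => ?_)
    rw [uIcc_of_le hab] at hτ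
    exact hgh τ (ha.trans hτ.1)

/-- `v` is the evolution family of the generator `h`. -/
structure IsEvolution (h : Cn n → ℝ → Cn n) (v : Cn n → ℝ → ℝ → Cn n) : Prop where
  self : ∀ z ∈ unitBall n, ∀ s, 0 ≤ s → v z s s = z
  curve : ∀ z ∈ unitBall n, ∀ s, 0 ≤ s → IsForwardCurve (fun x t => -h x t) s (v z s)
  norm_le : ∀ z ∈ unitBall n, ∀ s t, 0 ≤ s → s ≤ t → ‖v z s t‖ ≤ ‖z‖

theorem MemHA.exists_isEvolution (hh : MemHA A h) (hA : 0 < lowerIndex A) :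
    ∃ v, IsEvolution h v := by
  choose! v h1 h2 h3 using fun (z : Cn n) (s : ℝ) (H : 0 ≤ s ∧ z ∈ unitBall n) =>
    hh.exists_curve hA H.1 H.2
  exact ⟨v, fun z hz s hs => h1 z s ⟨hs, hz⟩, fun z hz s hs => h2 z s ⟨hs, hz⟩,
    fun z hz s t hs ht => h3 z s ⟨hs, hz⟩ t ht⟩

namespace IsEvolution

variable {v : Cn n → ℝ → ℝ → Cn n}

theorem mem_unitBall (hv : IsEvolution h v) {z : Cn n} (hz : z ∈ unitBall n) {s t : ℝ}
    (hs : 0 ≤ s) (hst : s ≤ t) : v z s t ∈ unitBall n := by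
  have := hv.norm_le z hz s t hs hst
  rw [mem_ball_zero_iff] at hz ⊢
  exact this.trans_lt hz

theorem norm_le_exp (hv : IsEvolution h v) (hh : MemHA A h) (hA : 0 < lowerIndex A) {r : ℝ}
    (hr : r < 1) {z : Cn n} (hz : ‖z‖ ≤ r) {s t : ℝ} (hs : 0 ≤ s) (hst : s ≤ t) :
    ‖v z s t‖ ≤ Real.exp (-((1 - r ^ 2) / 4 * lowerIndex A * (t - s))) := by
  have hr0 : 0 ≤ r := (norm_nonneg z).trans hz
  obtain ⟨M, L, hM, hL, hbd, hlip, -⟩ := hh.exists_bounds hA hr0 hr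
  have hzb : z ∈ unitBall n := by rw [mem_ball_zero_iff]; linarith
  have hn : ∀ τ, s ≤ τ → ‖v z s τ‖ ≤ r := fun τ hτ => (hv.norm_le z hzb s τ hs hτ).trans hz
  set c := (1 - r ^ 2) / 4 * lowerIndex A with hc
  have hc0 : 0 ≤ c := by
    have : 0 ≤ 1 - r ^ 2 := by nlinarith
    positivity
  have key := (hv.curve z hzb s hs).exp_mul_norm_sq_le (M := M) (L := L) (c := c) (t := t)
    (fun τ hτ => by rw [norm_neg]; exact hbd τ (hs.trans hτ) _ (hn τ hτ)) hL.le
    (fun a τ ha hτ => by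
      rw [neg_sub_neg, norm_sub_rev]
      exact hlip τ (hs.trans (ha.trans hτ)) _ _ (hn a ha) (hn τ (ha.trans hτ)))
    hc0 (fun a τ ha hτ => by
      rw [inner_neg_right, Complex.neg_re, neg_mul, neg_le_neg_iff]
      exact (hh.memNA τ (hs.trans (ha.trans hτ))).le_re_inner hA hr (hn a ha)) hst
  rw [hv.self z hzb s hs] at key
  have hz1 : ‖z‖ ^ 2 ≤ 1 := by nlinarith [norm_nonneg z]
  have h2 : ‖v z s t‖ ^ 2 ≤ Real.exp (-(c * (t - s))) ^ 2 := by
    have e : Real.exp (-(c * (t - s))) ^ 2 = (Real.exp (2 * c * t))⁻¹ * Real.exp (2 * c * s) := by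
      rw [← Real.exp_neg, ← Real.exp_add, ← Real.exp_nat_mul]; congr 1; push_cast; ring
    rw [e, le_inv_mul_iff₀ (Real.exp_pos _)]
    refine key.trans ?_
    nlinarith [Real.exp_pos (2 * c * s)]
  exact (sq_le_sq₀ (norm_nonneg _) (Real.exp_pos _).le).1 h2

/-- The evolution maps are bi-Lipschitz on smaller balls. -/
theorem exists_bilipschitz (hv : IsEvolution h v) (hh : MemHA A h) (hA : 0 < lowerIndex A)
    {r : ℝ} (hr0 : 0 ≤ r) (hr : r < 1) {s t : ℝ} (hs : 0 ≤ s) (hst : s ≤ t) :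
    ∃ C, 0 < C ∧ ∀ x y, ‖x‖ ≤ r → ‖y‖ ≤ r →
      ‖v x s t - v y s t‖ ≤ C * ‖x - y‖ ∧ ‖x - y‖ ≤ C * ‖v x s t - v y s t‖ := by
  obtain ⟨M, L, hM, hL, hbd, hlip, -⟩ := hh.exists_bounds hA hr0 hr
  refine ⟨Real.exp (L * (t - s)), Real.exp_pos _, fun x y hx hy => ?_⟩
  have hb : ∀ {z : Cn n}, ‖z‖ ≤ r → z ∈ unitBall n := fun hz => by
    rw [mem_ball_zero_iff]; linarith
  have hn : ∀ {z : Cn n}, ‖z‖ ≤ r → ∀ τ, s ≤ τ → ‖v z s τ‖ ≤ r := fun hz τ hτ =>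
    (hv.norm_le _ (hb hz) s τ hs hτ).trans hz
  have hM' : ∀ {z : Cn n}, ‖z‖ ≤ r → ∀ τ, s ≤ τ → ‖-h (v z s τ) τ‖ ≤ M := fun hz τ hτ => by
    rw [norm_neg]; exact hbd τ (hs.trans hτ) _ (hn hz τ hτ)
  have hL' : ∀ τ, s ≤ τ →
      ‖-h (v x s τ) τ - -h (v y s τ) τ‖ ≤ L * ‖v x s τ - v y s τ‖ := fun τ hτ => by
    rw [neg_sub_neg, norm_sub_rev]
    exact hlip τ (hs.trans hτ) _ _ (hn hy τ hτ) (hn hx τ hτ)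
  have h1 := (hv.curve x (hb hx) s hs).norm_sub_le_exp_mul (hv.curve y (hb hy) s hs)
    (hM' hx) (hM' hy) hL.le hL' hst
  have h2 := (hv.curve x (hb hx) s hs).norm_sub_le_exp_mul' (hv.curve y (hb hy) s hs)
    (hM' hx) (hM' hy) hL.le hL' hst
  rw [hv.self x (hb hx) s hs, hv.self y (hb hy) s hs] at h1 h2
  exact ⟨h1, h2⟩

/-- Both sides are trajectories from time `t` with the same initial point, so Gronwall gives
uniqueness. -/
theorem comp (hv : IsEvolution h v) (hh : MemHA A h) (hA : 0 < lowerIndex A) {z : Cn n}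
    (hz : z ∈ unitBall n) {s t T : ℝ} (hs : 0 ≤ s) (hst : s ≤ t) (htT : t ≤ T) :
    v (v z s t) t T = v z s T := by
  have ht : 0 ≤ t := hs.trans hst
  have hw := hv.mem_unitBall hz hs hst
  have hz1 : ‖z‖ < 1 := by simpa using hz
  obtain ⟨M, L, hM, hL, hbd, hlip, -⟩ := hh.exists_bounds hA (norm_nonneg z) hz1
  have hn1 : ∀ τ, t ≤ τ → ‖v (v z s t) t τ‖ ≤ ‖z‖ := fun τ hτ =>
    (hv.norm_le _ hw t τ ht hτ).trans (hv.norm_le z hz s t hs hst)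
  have hn2 : ∀ τ, t ≤ τ → ‖v z s τ‖ ≤ ‖z‖ := fun τ hτ => hv.norm_le z hz s τ hs (hst.trans hτ)
  have key := (hv.curve _ hw t ht).norm_sub_le_exp_mul ((hv.curve z hz s hs).mono hst) (M := M)
    (L := L) (fun τ hτ => by rw [norm_neg]; exact hbd τ (ht.trans hτ) _ (hn1 τ hτ))
    (fun τ hτ => by rw [norm_neg]; exact hbd τ (ht.trans hτ) _ (hn2 τ hτ)) hL.le
    (fun τ hτ => by
      rw [neg_sub_neg, norm_sub_rev]
      exact hlip τ (ht.trans hτ) _ _ (hn2 τ hτ) (hn1 τ hτ)) htT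
  rw [hv.self _ hw t ht, sub_self, norm_zero, mul_zero] at key
  exact sub_eq_zero.1 (norm_le_zero_iff.1 key)

end IsEvolution

end LoewnerPDE

/-! ### Regularity of solutions and constancy along trajectories -/

namespace LoewnerPDE

open Filter Topology

variable {n : ℕ} {A : Cn n →L[ℂ] Cn n} {h f : Cn n → ℝ → Cn n}

theorem exp_smul_mul_exp_neg_smul (A : Cn n →L[ℂ] Cn n) (t : ℂ) :
    NormedSpace.exp (t • A) * NormedSpace.exp ((-t) • A) = 1 := by
  let _ : NormedAlgebra ℚ (Cn n →L[ℂ] Cn n) := NormedAlgebra.restrictScalars ℚ ℂ _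
  have e : (-t) • A = -(t • A) := neg_smul t A
  rw [e, ← NormedSpace.exp_add_of_commute (Commute.refl (t • A)).neg_right,
    add_neg_cancel, NormedSpace.exp_zero]

theorem exp_neg_smul_mul_exp_smul (A : Cn n →L[ℂ] Cn n) (t : ℂ) :
    NormedSpace.exp ((-t) • A) * NormedSpace.exp (t • A) = 1 := by
  simpa using exp_smul_mul_exp_neg_smul A (-t)

theorem continuous_exp_smul (A : Cn n →L[ℂ] Cn n) :
    Continuous fun t : ℂ => NormedSpace.exp (t • A) :=
  continuous_iff_continuousAt.2 fun t => (hasDerivAt_exp_smul_const A t).continuousAt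

/-- On bounded time intervals polynomial boundedness is a plain local bound, which feeds all the
Cauchy estimates below. -/
theorem PolyBounded.exists_bound (hpoly : PolyBounded A f) {r : ℝ} (hr : r < 1) (T : ℝ) :
    ∃ B, ∀ t, 0 ≤ t → t ≤ T → ∀ z, ‖z‖ ≤ r → ‖f z t‖ ≤ B := by
  obtain ⟨C, P, hCP⟩ := hpoly (closedBall 0 r) (isCompact_closedBall _ _)
    (closedBall_subset_ball hr)
  have hc : Continuous fun t : ℝ => ‖NormedSpace.exp ((t : ℂ) • A)‖ * (C * P.eval t) :=
    (((continuous_exp_smul A).comp Complex.continuous_ofReal).norm).mul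
      (continuous_const.mul P.continuous)
  obtain ⟨B, hB⟩ := (isCompact_Icc (a := (0 : ℝ)) (b := T)).exists_bound_of_continuousOn
    hc.continuousOn
  refine ⟨B, fun t ht htT z hz => ?_⟩
  have e : f z t = NormedSpace.exp ((t : ℂ) • A) (NormedSpace.exp ((-t : ℂ) • A) (f z t)) := by
    rw [← mul_apply_eq_comp, exp_smul_mul_exp_neg_smul, one_apply_eq_self]
  have h1 := hCP z (by simpa using hz) t ht
  calc ‖f z t‖ ≤ ‖NormedSpace.exp ((t : ℂ) • A)‖ * ‖NormedSpace.exp ((-t : ℂ) • A) (f z t)‖ := by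
        conv_lhs => rw [e]
        exact ContinuousLinearMap.le_opNorm _ _
    _ ≤ ‖NormedSpace.exp ((t : ℂ) • A)‖ * (C * P.eval t) := by gcongr
    _ ≤ B := (le_abs_self _).trans (hB t ⟨ht, htT⟩)

theorem IsSolution.absolutelyContinuousOnInterval (hf : IsSolution h f) {z : Cn n}
    (hz : z ∈ unitBall n) {a b : ℝ} (ha : 0 ≤ a) (hab : a ≤ b) :
    AbsolutelyContinuousOnInterval (f z) a b := by
  have : AbsolutelyContinuousOnInterval (f z) 0 b := by
    rw [absolutelyContinuousOnInterval_iff]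
    intro ε hε
    obtain ⟨δ, hδ, H⟩ := hf.locUnifAC {z} isCompact_singleton (by simpa using hz) b
      (ha.trans hab) ε hε
    exact ⟨δ, hδ, H z rfl⟩
  refine this.mono ?_
  rw [uIcc_of_le hab, uIcc_of_le (ha.trans hab)]
  exact Icc_subset_Icc_left ha

theorem IsSolution.ae_hasDerivAt (hf : IsSolution h f) {z : Cn n} (hz : z ∈ unitBall n) {a b : ℝ}
    (ha : 0 ≤ a) : ∀ᵐ t, t ∈ Icc a b →
      HasDerivAt (f z) (fderiv ℂ (fun w => f w t) z (h z t)) t := by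
  filter_upwards [(ae_restrict_iff' measurableSet_Ici).1 (hf.eqn z hz)] with t ht htm
  exact ht (ha.trans htm.1)

theorem IsSolution.exists_space_bounds (hf : IsSolution h f) (hpoly : PolyBounded A f) {r : ℝ}
    (hr : r < 1) (T : ℝ) : ∃ K, 0 ≤ K ∧ ∀ t, 0 ≤ t → t ≤ T → ∀ x, ‖x‖ ≤ r →
      ‖fderiv ℂ (fun w => f w t) x‖ ≤ K ∧ ∀ y, ‖y‖ ≤ r →
      ‖fderiv ℂ (fun w => f w t) y - fderiv ℂ (fun w => f w t) x‖ ≤ K * ‖y - x‖ ∧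
      ‖f y t - f x t - fderiv ℂ (fun w => f w t) x (y - x)‖ ≤ K * ‖y - x‖ ^ 2 := by
  set R := (1 + r) / 2 with hR
  have hrR : r < R := by rw [hR]; linarith
  have hR1 : R < 1 := by rw [hR]; linarith
  obtain ⟨B, hB⟩ := hpoly.exists_bound hR1 T
  have hRr : 0 < R - r := by linarith
  have h1 : 0 ≤ 2 * |B| / (R - r) := by positivity
  have h2 : 0 ≤ 16 * |B| / (R - r) ^ 2 := by positivity
  refine ⟨2 * |B| / (R - r) + 16 * |B| / (R - r) ^ 2, by positivity, fun t ht htT x hx => ?_⟩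
  have hb : ∀ y ∈ ball (0 : Cn n) R, ‖f y t‖ ≤ |B| := fun y hy => by
    rw [mem_ball_zero_iff] at hy
    exact (hB t ht htT y hy.le).trans (le_abs_self B)
  have hd := (hf.holo t ht).mono (ball_subset_ball hR1.le)
  refine ⟨?_, fun y hy => ⟨?_, ?_⟩⟩
  · have := norm_fderiv_le_of_bounded_ball hrR hd hb hx
    linarith
  · refine (norm_fderiv_sub_le_of_bounded_ball hrR hd hb hx hy).trans ?_
    gcongr; linarith
  · refine (norm_taylor_le_of_bounded_ball hrR hd hb hx hy).trans ?_
    gcongr; linarith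

theorem IsSolution.exists_time_lipschitz (hh : MemHA A h) (hA : 0 < lowerIndex A)
    (hf : IsSolution h f) (hpoly : PolyBounded A f) {r : ℝ}
    (hr0 : 0 ≤ r) (hr : r < 1) (T : ℝ) : ∃ K, 0 ≤ K ∧ ∀ x, ‖x‖ ≤ r → ∀ a b, 0 ≤ a → a ≤ b → b ≤ T →
      ‖f x b - f x a‖ ≤ K * (b - a) := by
  obtain ⟨K, hK0, hK⟩ := hf.exists_space_bounds hpoly hr T
  obtain ⟨M, L, hM, hL, hbd, hlip, -⟩ := hh.exists_bounds hA hr0 hr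
  refine ⟨K * M, by positivity, fun x hx a b ha hab hbT => ?_⟩
  have hxb : x ∈ unitBall n := by rw [mem_ball_zero_iff]; linarith
  refine norm_sub_le_of_ae_hasDerivAt hab (hf.absolutelyContinuousOnInterval hxb ha hab) ?_
  filter_upwards [hf.ae_hasDerivAt hxb (b := b) ha] with t ht htm
  have ht0 := ha.trans htm.1
  refine ⟨_, ht htm, (ContinuousLinearMap.le_opNorm _ _).trans ?_⟩
  exact mul_le_mul (hK t ht0 (htm.2.trans hbT) x hx).1 (hbd t ht0 x hx) (norm_nonneg _) hK0

/-- Cauchy's estimate applied to `f(·,b) - f(·,a)` on a larger ball; the equation itself is never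
differentiated in `z`. -/
theorem IsSolution.exists_fderiv_time_lipschitz (hh : MemHA A h) (hA : 0 < lowerIndex A)
    (hf : IsSolution h f) (hpoly : PolyBounded A f) {r : ℝ}
    (hr0 : 0 ≤ r) (hr : r < 1) (T : ℝ) : ∃ K, 0 ≤ K ∧ ∀ x, ‖x‖ ≤ r → ∀ a b, 0 ≤ a → a ≤ b → b ≤ T →
      ‖fderiv ℂ (fun w => f w b) x - fderiv ℂ (fun w => f w a) x‖ ≤ K * (b - a) := by
  set R := (1 + r) / 2 with hR
  have hrR : r < R := by rw [hR]; linarith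
  have hR1 : R < 1 := by rw [hR]; linarith
  obtain ⟨K, hK0, hK⟩ := hf.exists_time_lipschitz hh hA hpoly (hr0.trans hrR.le) hR1 T
  have hRr : 0 < R - r := by linarith
  refine ⟨2 * K / (R - r), by positivity, fun x hx a b ha hab hbT => ?_⟩
  have hsub := ball_subset_ball (x := (0 : Cn n)) hR1.le
  have hxb : x ∈ ball (0 : Cn n) 1 := by rw [mem_ball_zero_iff]; linarith
  have hdb := hf.holo b (ha.trans hab)
  have hda := hf.holo a ha
  have key := norm_fderiv_le_of_bounded_ball (f := fun w => f w b - f w a) (M := K * (b - a)) hrR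
    ((hdb.sub hda).mono hsub) (fun y hy => by
      rw [mem_ball_zero_iff] at hy
      exact hK y hy.le a b ha hab hbT) hx
  rw [fderiv_fun_sub (hdb.differentiableAt (isOpen_ball.mem_nhds hxb))
    (hda.differentiableAt (isOpen_ball.mem_nhds hxb))] at key
  refine key.trans_eq (by ring)

theorem MemHA.intervalIntegrable (hh : MemHA A h) (hA : 0 < lowerIndex A) {z : Cn n}
    (hz : z ∈ unitBall n) {a b : ℝ} (ha : 0 ≤ a) (hab : a ≤ b) :
    IntervalIntegrable (h z) volume a b := by
  have hz1 : ‖z‖ < 1 := by simpa using hz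
  obtain ⟨M, L, hM, hL, hbd, -, -⟩ := hh.exists_bounds hA (norm_nonneg z) hz1
  have hsub : uIoc a b ⊆ Ici (0 : ℝ) := fun t ht => by
    rw [uIoc_of_le hab] at ht
    exact ha.trans ht.1.le
  refine (intervalIntegrable_const (c := M)).mono_fun
    ((hh.meas z hz).aestronglyMeasurable.mono_measure (Measure.restrict_mono_set _ hsub)) ?_
  filter_upwards [ae_restrict_mem measurableSet_uIoc] with t ht
  exact (hbd t (hsub ht) z le_rfl).trans (le_abs_self M)

theorem MemHA.norm_integral_le {M r : ℝ}
    (hbd : ∀ t, 0 ≤ t → ∀ x, ‖x‖ ≤ r → ‖h x t‖ ≤ M) {z : Cn n} (hz : ‖z‖ ≤ r)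
    {a b : ℝ} (ha : 0 ≤ a) (hab : a ≤ b) : ‖∫ τ in a..b, h z τ‖ ≤ M * (b - a) := by
  have := intervalIntegral.norm_integral_le_of_norm_le_const (a := a) (b := b) (f := h z) (C := M)
    (fun τ hτ => by
      rw [uIoc_of_le hab] at hτ
      exact hbd τ (ha.trans hτ.1.le) z hz)
  rwa [abs_of_nonneg (by linarith)] at this

/-- First-order expansion of a solution in time. -/
theorem IsSolution.exists_time_expansion (hh : MemHA A h) (hA : 0 < lowerIndex A)
    (hf : IsSolution h f) (hpoly : PolyBounded A f) {r : ℝ}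
    (hr0 : 0 ≤ r) (hr : r < 1) (T : ℝ) : ∃ K, 0 ≤ K ∧ ∀ x, ‖x‖ ≤ r → ∀ a b, 0 ≤ a → a ≤ b → b ≤ T →
      ‖f x b - f x a - fderiv ℂ (fun w => f w a) x (∫ τ in a..b, h x τ)‖ ≤ K * (b - a) ^ 2 := by
  obtain ⟨K, hK0, hK⟩ := hf.exists_fderiv_time_lipschitz hh hA hpoly hr0 hr T
  obtain ⟨M, L, hM, hL, hbd, hlip, -⟩ := hh.exists_bounds hA hr0 hr
  refine ⟨K * M, by positivity, fun x hx a b ha hab hbT => ?_⟩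
  have hxb : x ∈ unitBall n := by rw [mem_ball_zero_iff]; linarith
  set D := fderiv ℂ (fun w => f w a) x with hD
  have hint := hh.intervalIntegrable hA hxb ha hab
  have hHac : AbsolutelyContinuousOnInterval (fun t => ∫ τ in a..t, h x τ) a b := by
    refine LipschitzOnWith.absolutelyContinuousOnInterval (K := M.toNNReal) ?_
    refine LipschitzOnWith.of_dist_le_mul fun p hp q hq => ?_
    rw [uIcc_of_le hab] at hp hq
    rw [dist_eq_norm, intervalIntegral.integral_interval_sub_left
      (hh.intervalIntegrable hA hxb ha hp.1) (hh.intervalIntegrable hA hxb ha hq.1),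
      Real.coe_toNNReal _ hM.le, Real.dist_eq]
    rcases le_total q p with hqp | hqp
    · rw [abs_of_nonneg (by linarith)]
      exact MemHA.norm_integral_le hbd hx (ha.trans hq.1) hqp
    · rw [intervalIntegral.integral_symm, norm_neg, abs_sub_comm, abs_of_nonneg (by linarith)]
      exact MemHA.norm_integral_le hbd hx (ha.trans hp.1) hqp
  have hψ := (hf.absolutelyContinuousOnInterval hxb ha hab).sub
    (AbsolutelyContinuousOnInterval.clm_comp hHac (D.restrictScalars ℝ))
  -- At the fixed point `x` the difference has derivative `(Df(x,t) - Df(x,a)) h(x,t)`, which is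
  -- `O(b - a)`.
  have key := norm_sub_le_of_ae_hasDerivAt (M := K * (b - a) * M) hab hψ ?_
  · simp only [Pi.sub_apply, intervalIntegral.integral_same, map_zero, sub_zero] at key
    rw [show f x b - f x a - D (∫ τ in a..b, h x τ) = f x b - D (∫ τ in a..b, h x τ) - f x a by
      abel]
    exact key.trans_eq (by ring)
  · filter_upwards [hf.ae_hasDerivAt hxb (b := b) ha, hint.ae_hasDerivAt_integral] with t h1 h2 htm
    have h3 := h2 (by rwa [uIcc_of_le hab]) a (by simp)
    have h4 : HasDerivAt (fun t => (D.restrictScalars ℝ) (∫ τ in a..t, h x τ)) (D (h x t)) t :=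
      (D.restrictScalars ℝ).hasFDerivAt.comp_hasDerivAt t h3
    refine ⟨_, (h1 htm).sub h4, ?_⟩
    rw [← sub_apply]
    refine (ContinuousLinearMap.le_opNorm _ _).trans ?_
    have h5 := hK x hx a t ha htm.1 (htm.2.trans hbT)
    have h6 := hbd t (ha.trans htm.1) x hx
    have h7 : K * (t - a) ≤ K * (b - a) := by gcongr; exact htm.2
    exact mul_le_mul (h5.trans h7) h6 (norm_nonneg _) (by
      have : 0 ≤ b - a := by linarith
      positivity)

/-- A solution is constant along the trajectories of the generator. -/
theorem IsSolution.apply_evolution (hh : MemHA A h) (hA : 0 < lowerIndex A)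
    (hf : IsSolution h f) (hpoly : PolyBounded A f) {v : Cn n → ℝ → ℝ → Cn n}
    (hv : IsEvolution h v) {z : Cn n} (hz : z ∈ unitBall n) {s t : ℝ} (hs : 0 ≤ s) (hst : s ≤ t) :
    f (v z s t) t = f z s := by
  have hz1 : ‖z‖ < 1 := by simpa using hz
  have hr0 := norm_nonneg z
  obtain ⟨K₁, hK₁0, hK₁⟩ := hf.exists_space_bounds hpoly hz1 t
  obtain ⟨K₂, hK₂0, hK₂⟩ := hf.exists_fderiv_time_lipschitz hh hA hpoly hr0 hz1 t
  obtain ⟨K₃, hK₃0, hK₃⟩ := hf.exists_time_expansion hh hA hpoly hr0 hz1 t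
  obtain ⟨M, L, hM, hL, hbd, hlip, -⟩ := hh.exists_bounds hA hr0 hz1
  set u := v z s with hu
  have hn : ∀ τ, s ≤ τ → ‖u τ‖ ≤ ‖z‖ := fun τ hτ => hv.norm_le z hz s τ hs hτ
  have hcurve := hv.curve z hz s hs
  have hlipu : ∀ {a b : ℝ}, s ≤ a → a ≤ b → ‖u b - u a‖ ≤ M * (b - a) := fun ha hab =>
    hcurve.norm_sub_le (fun τ hτ => by rw [norm_neg]; exact hbd τ (hs.trans hτ) _ (hn τ hτ)) ha hab
  have key := eq_of_norm_increment_le_sq (φ := fun τ => f (u τ) τ)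
    (C := K₁ * M ^ 2 + K₂ * M + K₁ * (L * M) + K₃) hst ?_
  · simp only [hu, hv.self z hz s hs] at key
    exact key
  intro a b ha hab hbt
  have ha0 : 0 ≤ a := hs.trans ha
  have hk : 0 ≤ b - a := by linarith
  set Da := fderiv ℂ (fun w => f w a) (u a)
  set Db := fderiv ℂ (fun w => f w b) (u a)
  set H := ∫ τ in a..b, h (u a) τ with hH
  have hua := hn a ha
  have hub := hn b (ha.trans hab)
  -- The four terms are the spatial Taylor remainder at time `b`, the drift of the derivative in
  -- time, the cancellation of `u' = -h` against `h`, and the time-expansion remainder. Each is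
  -- `O((b - a)²)`.
  have e : f (u b) b - f (u a) a = (f (u b) b - f (u a) b - Db (u b - u a))
      + (Db - Da) (u b - u a) + Da ((u b - u a) + H) + (f (u a) b - f (u a) a - Da H) := by
    simp only [sub_apply, map_add]
    abel
  have h1 : ‖f (u b) b - f (u a) b - Db (u b - u a)‖ ≤ K₁ * (M * (b - a)) ^ 2 := by
    refine ((hK₁ b (ha0.trans hab) hbt (u a) hua).2 (u b) hub).2.trans ?_
    gcongr
    exact hlipu ha hab
  have h2 : ‖(Db - Da) (u b - u a)‖ ≤ K₂ * (b - a) * (M * (b - a)) := by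
    refine (ContinuousLinearMap.le_opNorm _ _).trans ?_
    have := hK₂ (u a) hua a b ha0 hab hbt
    have := hlipu ha hab
    gcongr
  have h3 : ‖(u b - u a) + H‖ ≤ L * (M * (b - a)) * (b - a) := by
    have hub' : u a ∈ unitBall n := by rw [mem_ball_zero_iff]; linarith
    have hint := hh.intervalIntegrable hA hub' ha0 hab
    rw [hcurve.incr a b ha hab, hH, ← intervalIntegral.integral_add (hcurve.intble a b ha hab) hint]
    have := intervalIntegral.norm_integral_le_of_norm_le_const (a := a) (b := b)
      (f := fun τ => -h (u τ) τ + h (u a) τ) (C := L * (M * (b - a))) (fun τ hτ => by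
        rw [uIoc_of_le hab] at hτ
        have hτa := hτ.1.le
        rw [neg_add_eq_sub]
        refine (hlip τ (ha0.trans hτa) _ _ (hn τ (ha.trans hτa)) hua).trans ?_
        gcongr
        rw [norm_sub_rev]
        refine (hlipu ha hτa).trans ?_
        gcongr
        exact hτ.2)
    rwa [abs_of_nonneg hk] at this
  have h4 : ‖Da ((u b - u a) + H)‖ ≤ K₁ * (L * (M * (b - a)) * (b - a)) := by
    refine (ContinuousLinearMap.le_opNorm _ _).trans ?_
    exact mul_le_mul (hK₁ a ha0 (hab.trans hbt) (u a) hua).1 h3 (norm_nonneg _) hK₁0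
  have h5 := hK₃ (u a) hua a b ha0 hab hbt
  rw [e]
  refine (norm_add₄_le).trans ?_
  refine (add_le_add (add_le_add (add_le_add h1 h2) h4) h5).trans_eq ?_
  ring

end LoewnerPDE

/-! ### The derivative at the origin -/

namespace LoewnerPDE

open Filter Topology

variable {n : ℕ} {A : Cn n →L[ℂ] Cn n} {h f : Cn n → ℝ → Cn n}

/-- Close to the fixed point, a solution moves by `Df(0,a) A x` to first order, with an error that
is small in `x` as well as in time. -/
theorem IsSolution.exists_time_expansion_zero (hh : MemHA A h) (hA : 0 < lowerIndex A)
    (hf : IsSolution h f) (hpoly : PolyBounded A f) (T : ℝ) : ∃ K, 0 ≤ K ∧ ∀ a b, 0 ≤ a → a ≤ b →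
      b ≤ T → ∀ x, ‖x‖ ≤ 1 / 2 →
      ‖f x b - f x a - (b - a) • fderiv ℂ (fun w => f w a) 0 (A x)‖
        ≤ K * (‖x‖ ^ 2 + (b - a) * ‖x‖) * (b - a) := by
  have hr0 : (0 : ℝ) ≤ 1 / 2 := by norm_num
  have hr : (1 / 2 : ℝ) < 1 := by norm_num
  have h0 : ‖(0 : Cn n)‖ ≤ 1 / 2 := by simp
  obtain ⟨K₁, hK₁0, hK₁⟩ := hf.exists_space_bounds hpoly hr T
  obtain ⟨K₂, hK₂0, hK₂⟩ := hf.exists_fderiv_time_lipschitz hh hA hpoly hr0 hr T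
  obtain ⟨M, L, hM, hL, hbd, hlip, htay⟩ := hh.exists_bounds hA hr0 hr
  refine ⟨K₁ * (2 * L) + K₂ * L, by positivity, fun a b ha hab hbT x hx => ?_⟩
  have hxb : x ∈ unitBall n := by rw [mem_ball_zero_iff]; linarith
  set D := fderiv ℂ (fun w => f w a) 0 with hD
  have hlin : ∀ t : ℝ, HasDerivAt (fun t : ℝ => (t - a) • D (A x)) (D (A x)) t := fun t => by
    simpa using ((hasDerivAt_id t).sub_const a).smul_const (D (A x))
  have hψ := (hf.absolutelyContinuousOnInterval hxb ha hab).sub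
    (ContDiffOn.absolutelyContinuousOnInterval (f := fun t : ℝ => (t - a) • D (A x))
      (ContDiff.contDiffOn (by fun_prop)))
  have key := norm_sub_le_of_ae_hasDerivAt
    (M := (K₁ * (2 * L) + K₂ * L) * (‖x‖ ^ 2 + (b - a) * ‖x‖)) hab hψ ?_
  · simp only [Pi.sub_apply, sub_self, zero_smul, sub_zero] at key
    rwa [sub_right_comm]
  · filter_upwards [hf.ae_hasDerivAt hxb (b := b) ha] with t h1 htm
    refine ⟨_, (h1 htm).sub (hlin t), ?_⟩
    have ht0 := ha.trans htm.1
    have htT := htm.2.trans hbT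
    set Dt := fderiv ℂ (fun w => f w t) x
    set D0 := fderiv ℂ (fun w => f w t) 0
    have e : Dt (h x t) - D (A x) = (Dt - D0) (h x t) + (D0 - D) (h x t) + D (h x t - A x) := by
      simp only [sub_apply, map_sub]; abel
    have hhx : ‖h x t‖ ≤ L * ‖x‖ := by
      simpa [(hh.memNA t ht0).apply_zero] using hlip t ht0 0 x h0 hx
    have h2 : ‖(Dt - D0) (h x t)‖ ≤ K₁ * ‖x‖ * (L * ‖x‖) := by
      refine (ContinuousLinearMap.le_opNorm _ _).trans ?_
      have := ((hK₁ t ht0 htT 0 h0).2 x hx).1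
      rw [sub_zero] at this
      gcongr
    have h3 : ‖(D0 - D) (h x t)‖ ≤ K₂ * (b - a) * (L * ‖x‖) := by
      refine (ContinuousLinearMap.le_opNorm _ _).trans ?_
      have h4 := hK₂ 0 h0 a t ha htm.1 htT
      have h5 : K₂ * (t - a) ≤ K₂ * (b - a) := by gcongr; exact htm.2
      exact mul_le_mul (h4.trans h5) hhx (norm_nonneg _)
        (mul_nonneg hK₂0 (by linarith))
    have h6 : ‖D (h x t - A x)‖ ≤ K₁ * (L * ‖x‖ ^ 2) := by
      refine (ContinuousLinearMap.le_opNorm _ _).trans ?_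
      exact mul_le_mul (hK₁ a ha (hab.trans hbT) 0 h0).1 (htay t ht0 x hx) (norm_nonneg _) hK₁0
    rw [e]
    refine (norm_add₃_le).trans ((add_le_add (add_le_add h2 h3) h6).trans ?_)
    have h7 : 0 ≤ K₁ * (2 * L) * ((b - a) * ‖x‖) :=
      mul_nonneg (by positivity) (mul_nonneg (by linarith) (norm_nonneg _))
    have h8 : 0 ≤ K₂ * L * ‖x‖ ^ 2 := by positivity
    nlinarith

/-- A discrete form of `Y' = Y A` for `Y(t) = Df(0,t)`. In the expansion near the fixed point, put
`x = εw`, divide by `ε` and let `ε → 0`: the errors quadratic in `x` disappear, and the term linear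
in `x` keeps its factor `(b - a)²`. -/
theorem IsSolution.exists_fderiv_zero_expansion (hh : MemHA A h) (hA : 0 < lowerIndex A)
    (hf : IsSolution h f) (hpoly : PolyBounded A f) (T : ℝ) : ∃ K, 0 ≤ K ∧ ∀ a b, 0 ≤ a → a ≤ b →
      b ≤ T → ‖fderiv ℂ (fun w => f w b) 0 - fderiv ℂ (fun w => f w a) 0
        - ((b - a : ℝ) : ℂ) • (fderiv ℂ (fun w => f w a) 0 * A)‖ ≤ K * (b - a) ^ 2 := by
  have h0 : ‖(0 : Cn n)‖ ≤ 1 / 2 := by simp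
  obtain ⟨K₁, hK₁0, hK₁⟩ := hf.exists_space_bounds hpoly (r := 1 / 2) (by norm_num) T
  obtain ⟨K, hK0, hK⟩ := hf.exists_time_expansion_zero hh hA hpoly T
  refine ⟨K, hK0, fun a b ha hab hbT => ?_⟩
  have hk : 0 ≤ b - a := by linarith
  set Db := fderiv ℂ (fun w => f w b) 0 with hDb
  set Da := fderiv ℂ (fun w => f w a) 0 with hDa
  set E := Db - Da - ((b - a : ℝ) : ℂ) • (Da * A) with hE
  refine ContinuousLinearMap.opNorm_le_of_ball (ε := 1 / 2) (by norm_num) (by positivity)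
    (fun w hw => ?_)
  rw [mem_ball_zero_iff] at hw
  -- At `x = 0` the error bound vanishes, so `f(0,·)` does not move.
  have hf0 : f 0 b = f 0 a := by
    have := hK a b ha hab hbT 0 h0
    simpa [sub_eq_zero] using this
  have key : ∀ ε : ℝ, 0 < ε → ε ≤ 1 →
      ‖E w‖ ≤ (2 * K₁ + K * (b - a)) * ‖w‖ ^ 2 * ε + K * (b - a) ^ 2 * ‖w‖ := by
    intro ε hε hε1
    set x : Cn n := (ε : ℂ) • w with hx
    have hxn : ‖x‖ = ε * ‖w‖ := by
      rw [hx, norm_smul, Complex.norm_real, Real.norm_of_nonneg hε.le]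
    have hx2 : ‖x‖ ≤ 1 / 2 := by
      rw [hxn]; nlinarith [norm_nonneg w]
    have h1 := hK a b ha hab hbT x hx2
    have h2 := ((hK₁ b (ha.trans hab) hbT 0 h0).2 x hx2).2
    have h3 := ((hK₁ a ha (hab.trans hbT) 0 h0).2 x hx2).2
    rw [sub_zero] at h2 h3
    have e : E x = (f x b - f x a - (b - a) • Da (A x)) - (f x b - f 0 b - Db x)
        + (f x a - f 0 a - Da x) := by
      rw [hf0, hE]
      simp only [sub_apply, smul_apply, mul_apply_eq_comp, Complex.coe_smul]
      abel
    have h4 : ‖E x‖ = ε * ‖E w‖ := by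
      rw [hx, map_smul, norm_smul, Complex.norm_real, Real.norm_of_nonneg hε.le]
    have h5 := (norm_add_le ((f x b - f x a - (b - a) • Da (A x)) - (f x b - f 0 b - Db x))
      (f x a - f 0 a - Da x)).trans (add_le_add_left (norm_sub_le _ _) _)
    rw [← e, h4] at h5
    rw [hxn] at h1 h2 h3
    have h6 : ε * ‖E w‖ ≤
        ε * ((2 * K₁ + K * (b - a)) * ‖w‖ ^ 2 * ε + K * (b - a) ^ 2 * ‖w‖) := by
      refine (h5.trans (add_le_add (add_le_add h1 h2) h3)).trans_eq ?_
      ring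
    exact le_of_mul_le_mul_left h6 hε
  have hlim : Tendsto (fun ε : ℝ => (2 * K₁ + K * (b - a)) * ‖w‖ ^ 2 * ε
      + K * (b - a) ^ 2 * ‖w‖) (𝓝[>] 0) (𝓝 (K * (b - a) ^ 2 * ‖w‖)) := by
    have : Continuous fun ε : ℝ => (2 * K₁ + K * (b - a)) * ‖w‖ ^ 2 * ε
      + K * (b - a) ^ 2 * ‖w‖ := by fun_prop
    have h := this.tendsto 0
    rw [mul_zero, zero_add] at h
    exact h.mono_left nhdsWithin_le_nhds
  refine ge_of_tendsto hlim ?_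
  filter_upwards [self_mem_nhdsWithin, nhdsWithin_le_nhds (Iic_mem_nhds (zero_lt_one' ℝ))]
    with ε h1 h2 using key ε h1 h2

theorem exists_exp_expansion (A : Cn n →L[ℂ] Cn n) {T : ℝ} (hT : 0 ≤ T) : ∃ K, 0 ≤ K ∧
    ∀ a b : ℝ, 0 ≤ a → a ≤ b → b ≤ T →
      ‖NormedSpace.exp ((-a : ℂ) • A) - NormedSpace.exp ((-b : ℂ) • A)
        - ((b - a : ℝ) : ℂ) • (A * NormedSpace.exp ((-b : ℂ) • A))‖ ≤ K * (b - a) ^ 2 := by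
  have hd : ∀ ζ : ℂ, HasDerivAt (fun ζ : ℂ => NormedSpace.exp (ζ • A))
      (A * NormedSpace.exp (ζ • A)) ζ := fun ζ => hasDerivAt_exp_smul_const' A ζ
  obtain ⟨B, hB⟩ := (isCompact_closedBall (0 : ℂ) (T + 1)).exists_bound_of_continuousOn
    (continuous_exp_smul A).continuousOn
  have hB0 : 0 ≤ B := (norm_nonneg _).trans (hB 0 (mem_closedBall_self (by linarith)))
  refine ⟨16 * B / (T + 1 - T) ^ 2, by positivity, fun a b ha hab hbT => ?_⟩
  have hn : ∀ t : ℝ, 0 ≤ t → t ≤ T → ‖(-t : ℂ)‖ ≤ T := fun t h1 h2 => by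
    rw [norm_neg, Complex.norm_real, Real.norm_of_nonneg h1]; exact h2
  have key := norm_taylor_le_of_bounded_ball (f := fun ζ : ℂ => NormedSpace.exp (ζ • A))
    (lt_add_one T) (fun ζ _ => (hd ζ).differentiableAt.differentiableWithinAt)
    (fun y hy => hB y (ball_subset_closedBall hy)) (hn b (ha.trans hab) hbT)
    (hn a ha (hab.trans hbT))
  rw [(hd _).hasFDerivAt.fderiv, show (-a : ℂ) - (-b : ℂ) = ((b - a : ℝ) : ℂ) by push_cast; ring,
    Complex.norm_real, Real.norm_of_nonneg (by linarith)] at key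
  simpa using key

/-- `Df(0,t) = e^{tA}`. -/
theorem IsSolution.exp_mul_fderiv_zero (hh : MemHA A h) (hA : 0 < lowerIndex A)
    (hf : IsSolution h f) (hnorm : IsNormalized f) (hpoly : PolyBounded A f) {T : ℝ}
    (hT : 0 ≤ T) :
    NormedSpace.exp ((-T : ℂ) • A) * fderiv ℂ (fun w => f w T) 0 = 1 := by
  obtain ⟨K₁, hK₁0, hK₁⟩ := hf.exists_space_bounds hpoly (r := 1 / 2) (by norm_num) T
  obtain ⟨K₂, hK₂0, hK₂⟩ := hf.exists_fderiv_zero_expansion hh hA hpoly T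
  obtain ⟨K₃, hK₃0, hK₃⟩ := exists_exp_expansion A hT
  obtain ⟨B, hB⟩ := (isCompact_Icc (a := (0 : ℝ)) (b := T)).exists_bound_of_continuousOn
    (f := fun t : ℝ => NormedSpace.exp ((-t : ℂ) • A))
    ((continuous_exp_smul A).comp (Complex.continuous_ofReal.neg)).continuousOn
  set Y : ℝ → (Cn n →L[ℂ] Cn n) := fun t => fderiv ℂ (fun w => f w t) 0 with hY
  -- Since `Y' = Y A`, the product `Y(t) e^{-tA}` should be constant; its increments are quadratic.
  have key := eq_of_norm_increment_le_sq
    (φ := fun t : ℝ => Y t * NormedSpace.exp ((-t : ℂ) • A)) (C := K₂ * B + K₁ * K₃) hT ?_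
  · have hY0 : Y 0 = 1 := hnorm.deriv
    have h1 : Y T * NormedSpace.exp ((-T : ℂ) • A) = 1 := by
      have e : (-((0 : ℝ) : ℂ)) • A = 0 := by
        rw [Complex.ofReal_zero, neg_zero]; exact zero_smul ℂ A
      rw [key, hY0, e, NormedSpace.exp_zero, mul_one]
    have h2 : Y T = NormedSpace.exp ((T : ℂ) • A) := by
      calc Y T = Y T * NormedSpace.exp ((-T : ℂ) • A) * NormedSpace.exp ((T : ℂ) • A) := by
            rw [mul_assoc, exp_neg_smul_mul_exp_smul, mul_one]
        _ = _ := by rw [h1, one_mul]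
    show NormedSpace.exp ((-T : ℂ) • A) * Y T = 1
    rw [h2, exp_neg_smul_mul_exp_smul]
  · intro a b ha hab hbT
    set ea := NormedSpace.exp ((-a : ℂ) • A)
    set eb := NormedSpace.exp ((-b : ℂ) • A)
    have e : Y b * eb - Y a * ea = (Y b - Y a - ((b - a : ℝ) : ℂ) • (Y a * A)) * eb
        - Y a * (ea - eb - ((b - a : ℝ) : ℂ) • (A * eb)) := by
      simp only [sub_mul, mul_sub, smul_mul_assoc, mul_smul_comm, mul_assoc]
      abel
    rw [e]
    refine (norm_sub_le _ _).trans ?_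
    have h1 : ‖(Y b - Y a - ((b - a : ℝ) : ℂ) • (Y a * A)) * eb‖ ≤ K₂ * (b - a) ^ 2 * B :=
      (norm_mul_le _ _).trans (mul_le_mul (hK₂ a b ha hab hbT) (hB b ⟨ha.trans hab, hbT⟩)
        (norm_nonneg _) (by positivity))
    have h2 : ‖Y a * (ea - eb - ((b - a : ℝ) : ℂ) • (A * eb))‖ ≤ K₁ * (K₃ * (b - a) ^ 2) :=
      (norm_mul_le _ _).trans (mul_le_mul (hK₁ a ha (hab.trans hbT) 0 (by simp)).1
        (hK₃ a b ha hab hbT) (norm_nonneg _) hK₁0)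
    refine (add_le_add h1 h2).trans_eq (by ring)

end LoewnerPDE

/-! ### Univalence of solutions and holomorphy of the evolution family -/

namespace LoewnerPDE

open Filter Topology

variable {n : ℕ} {A : Cn n →L[ℂ] Cn n} {h f : Cn n → ℝ → Cn n}

theorem tendsto_polynomial_mul_exp_neg (P : Polynomial ℝ) {c : ℝ} (hc : 0 < c) (t : ℝ) :
    Tendsto (fun T => P.eval T * Real.exp (-(c * (T - t)))) atTop (𝓝 0) := by
  have h1 := (P.comp (Polynomial.C c⁻¹ * Polynomial.X)).tendsto_div_exp_atTop.comp
    (tendsto_id.const_mul_atTop hc)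
  have h2 := h1.mul_const (Real.exp (c * t))
  rw [zero_mul] at h2
  refine h2.congr fun T => ?_
  simp only [Function.comp_apply, id, Polynomial.eval_comp, Polynomial.eval_mul,
    Polynomial.eval_C, Polynomial.eval_X, inv_mul_cancel_left₀ hc.ne']
  rw [div_eq_mul_inv, ← Real.exp_neg, mul_assoc, ← Real.exp_add]
  ring_nf

/-- On balls whose radius decays exponentially, the maps `f(·,T)` are eventually injective and have
invertible derivatives. -/
theorem IsSolution.eventually_injOn (hh : MemHA A h) (hA : 0 < lowerIndex A)
    (hf : IsSolution h f) (hnorm : IsNormalized f) (hpoly : PolyBounded A f) {c : ℝ} (hc : 0 < c)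
    (t : ℝ) : ∀ᶠ T in atTop,
      InjOn (fun z => f z T) (closedBall 0 (Real.exp (-(c * (T - t))))) ∧
      ∀ x ∈ closedBall (0 : Cn n) (Real.exp (-(c * (T - t)))),
        ∃ L : Cn n ≃L[ℂ] Cn n, HasFDerivAt (fun z => f z T) (L : Cn n →L[ℂ] Cn n) x := by
  obtain ⟨C, P, hCP⟩ := hpoly (closedBall 0 (1 / 2)) (isCompact_closedBall _ _)
    (closedBall_subset_ball (by norm_num))
  have hlim1 := tendsto_polynomial_mul_exp_neg 1 hc t
  have hlim2 := (tendsto_polynomial_mul_exp_neg P hc t).const_mul C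
  rw [mul_zero] at hlim2
  -- The radii `1/4 < 1/2` give the Cauchy constant `16B/(1/4)² = 256B`, so `Bδ ≤ 1/512` keeps the
  -- derivative within `1/2` of the identity.
  filter_upwards [eventually_ge_atTop 0, hlim1.eventually_le_const (u := 1 / 4) (by norm_num),
    hlim2.eventually_le_const (u := 1 / 512) (by norm_num)] with T hT hδ1 hδ2
  rw [Polynomial.eval_one, one_mul] at hδ1
  set δ := Real.exp (-(c * (T - t))) with hδ
  have hδ0 : 0 < δ := Real.exp_pos _
  set e := NormedSpace.exp ((-T : ℂ) • A) with he
  set B := C * P.eval T with hB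
  have hb : ∀ y ∈ ball (0 : Cn n) (1 / 2), ‖e (f y T)‖ ≤ B := fun y hy =>
    hCP y (ball_subset_closedBall hy) T hT
  have hdf : ∀ y ∈ ball (0 : Cn n) (1 / 2), DifferentiableAt ℂ (fun z => f z T) y := fun y hy =>
    (hf.holo T hT).differentiableAt (isOpen_ball.mem_nhds (ball_subset_ball (by norm_num) hy))
  have hdg : ∀ y ∈ ball (0 : Cn n) (1 / 2), HasFDerivAt (fun z => e (f z T))
      (e * fderiv ℂ (fun z => f z T) y) y := fun y hy =>
    e.hasFDerivAt.comp y (hdf y hy).hasFDerivAt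
  have hsub : closedBall (0 : Cn n) δ ⊆ ball 0 (1 / 2) := closedBall_subset_ball (by linarith)
  have hclose : ∀ x ∈ closedBall (0 : Cn n) δ, ‖e * fderiv ℂ (fun z => f z T) x - 1‖ ≤ 1 / 2 := by
    intro x hx
    have hxδ : ‖x‖ ≤ δ := by simpa using hx
    have h1 := norm_fderiv_sub_le_of_bounded_ball (r := 1 / 4) (R := 1 / 2)
      (f := fun z => e (f z T)) (by norm_num)
      (fun y hy => (hdg y hy).differentiableAt.differentiableWithinAt) hb (x := 0) (y := x)
      (by simp) (hxδ.trans hδ1)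
    rw [(hdg x (hsub hx)).fderiv, (hdg 0 (by simp)).fderiv,
      hf.exp_mul_fderiv_zero hh hA hnorm hpoly hT, sub_zero] at h1
    have hB0 : 0 ≤ B := (norm_nonneg _).trans (hb 0 (by simp))
    have h2 : B * ‖x‖ ≤ 1 / 512 := by
      calc B * ‖x‖ ≤ B * δ := by gcongr
        _ = C * (P.eval T * δ) := by rw [hB]; ring
        _ ≤ _ := hδ2
    refine h1.trans ?_
    calc 16 * B / (1 / 2 - 1 / 4) ^ 2 * ‖x‖ = 256 * (B * ‖x‖) := by ring
      _ ≤ 1 / 2 := by linarith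
  refine ⟨fun x hx y hy hxy => ?_, fun x hx => ?_⟩
  · have h1 := Convex.norm_image_sub_le_of_norm_hasFDerivWithin_le' (𝕜 := ℂ) (C := 1 / 2)
      (f := fun z => e (f z T)) (φ := 1)
      (fun z hz => (hdg z (hsub hz)).hasFDerivWithinAt) hclose (convex_closedBall _ _) hx hy
    have hxy' : f x T = f y T := hxy
    simp only [hxy', sub_self, zero_sub, norm_neg, one_apply_eq_self] at h1
    have h2 : ‖y - x‖ ≤ 0 := by linarith
    exact (sub_eq_zero.1 (norm_le_zero_iff.1 h2)).symm
  · set D := fderiv ℂ (fun z => f z T) x with hD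
    -- From `w = e(Dw) - (eD - 1)w` one gets `‖w‖ ≤ ‖e‖‖Dw‖ + ‖w‖/2`; the `+ 1` keeps the
    -- denominator positive.
    obtain ⟨L, hL⟩ := exists_equiv_of_lower_bound D (c := 1 / (2 * (‖e‖ + 1))) (by positivity)
      (fun w => by
        have h1 := ((e * D - 1).le_opNorm w).trans
          (mul_le_mul_of_nonneg_right (hclose x hx) (norm_nonneg w))
        have h2 : w = e (D w) - (e * D - 1) w := by
          simp only [sub_apply, mul_apply_eq_comp, one_apply_eq_self]; abel
        have h3 := norm_sub_le (e (D w)) ((e * D - 1) w)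
        rw [← h2] at h3
        have h4 := e.le_opNorm (D w)
        rw [div_mul_eq_mul_div, div_le_iff₀ (by positivity)]
        nlinarith [norm_nonneg (D w)])
    exact ⟨L, by rw [hL]; exact (hdf x (hsub hx)).hasFDerivAt⟩

/-- Equal values at time `s` remain equal along the two trajectories, which at some late `T` lie in
the ball where `f(·,T)` is injective. The trajectories therefore meet, and backward Gronwall
identifies their initial points. -/
theorem IsSolution.injOn (hh : MemHA A h) (hA : 0 < lowerIndex A)
    (hf : IsSolution h f) (hnorm : IsNormalized f) (hpoly : PolyBounded A f)
    {v : Cn n → ℝ → ℝ → Cn n} (hv : IsEvolution h v) {s : ℝ} (hs : 0 ≤ s) :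
    InjOn (fun z => f z s) (unitBall n) := by
  intro x hx y hy hxy
  have hxy : f x s = f y s := hxy
  set r := max ‖x‖ ‖y‖ with hr
  have hr1 : r < 1 := max_lt (by simpa using hx) (by simpa using hy)
  have hxr : ‖x‖ ≤ r := le_max_left _ _
  have hyr : ‖y‖ ≤ r := le_max_right _ _
  have hr0 : 0 ≤ r := (norm_nonneg x).trans hxr
  have hc : 0 < (1 - r ^ 2) / 4 * lowerIndex A := by
    have : 0 < 1 - r ^ 2 := by nlinarith
    positivity
  obtain ⟨T, ⟨hinj, -⟩, hsT⟩ :=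
    ((hf.eventually_injOn hh hA hnorm hpoly hc s).and (eventually_ge_atTop s)).exists
  have h1 : v x s T = v y s T := hinj
    (by simpa using hv.norm_le_exp hh hA hr1 hxr hs hsT)
    (by simpa using hv.norm_le_exp hh hA hr1 hyr hs hsT)
    (by
      show f (v x s T) T = f (v y s T) T
      rw [hf.apply_evolution hh hA hpoly hv hx hs hsT,
        hf.apply_evolution hh hA hpoly hv hy hs hsT, hxy])
  obtain ⟨C, -, hC⟩ := hv.exists_bilipschitz hh hA hr0 hr1 hs hsT
  have h2 := (hC x y hxr hyr).2
  rw [h1, sub_self, norm_zero, mul_zero] at h2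
  exact sub_eq_zero.1 (norm_le_zero_iff.1 h2)

/-- Pass to the limit in the difference quotients along `x + w/(k+1)`. -/
theorem lower_bound_of_hasFDerivAt {E F : Type*} [NormedAddCommGroup E] [NormedSpace ℂ E]
    [NormedAddCommGroup F] [NormedSpace ℂ F] {φ : E → F} {D : E →L[ℂ] F} {x : E} {C : ℝ}
    (hC : 0 < C) (hφ : HasFDerivAt φ D x)
    (h : ∀ᶠ y in 𝓝 x, ‖y - x‖ ≤ C * ‖φ y - φ x‖) (w : E) : C⁻¹ * ‖w‖ ≤ ‖D w‖ := by
  have h1 : Tendsto (fun k : ℕ => ‖((k : ℂ) + 1)‖) atTop atTop := by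
    have : (fun k : ℕ => ‖((k : ℂ) + 1)‖) = fun k : ℕ => (k : ℝ) + 1 := by
      ext k
      rw [← Nat.cast_add_one, Complex.norm_natCast, Nat.cast_add_one]
    rw [this]
    exact tendsto_atTop_add_const_right _ _ tendsto_natCast_atTop_atTop
  have h2 := (hφ.lim w h1).norm
  have h3 : Tendsto (fun k : ℕ => x + ((k : ℂ) + 1)⁻¹ • w) atTop (𝓝 x) := by
    have h4 : Tendsto (fun k : ℕ => ((k : ℂ) + 1)⁻¹) atTop (𝓝 0) :=
      tendsto_inv₀_cobounded.comp (tendsto_norm_atTop_iff_cobounded.1 h1)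
    simpa using (h4.smul_const w).const_add x
  refine ge_of_tendsto h2 ?_
  filter_upwards [h3.eventually h] with k hk
  have hk0 : ((k : ℂ) + 1) ≠ 0 := Nat.cast_add_one_ne_zero k
  rw [add_sub_cancel_left, norm_smul, norm_inv, inv_mul_le_iff₀ (norm_pos_iff.2 hk0)] at hk
  rw [norm_smul, inv_mul_le_iff₀ hC]
  linarith

theorem IsSolution.differentiableOn_evolution (hh : MemHA A h) (hA : 0 < lowerIndex A)
    (hf : IsSolution h f) (hnorm : IsNormalized f) (hpoly : PolyBounded A f)
    {v : Cn n → ℝ → ℝ → Cn n} (hv : IsEvolution h v) {s t : ℝ} (hs : 0 ≤ s) (hst : s ≤ t) :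
    DifferentiableOn ℂ (fun z => v z s t) (unitBall n) := by
  intro z hz
  refine DifferentiableAt.differentiableWithinAt ?_
  have hz1 : ‖z‖ < 1 := by simpa using hz
  set r := (1 + ‖z‖) / 2 with hr
  have hzr : ‖z‖ < r := by rw [hr]; linarith
  have hr1 : r < 1 := by rw [hr]; linarith
  have hr0 : 0 ≤ r := (norm_nonneg z).trans hzr.le
  have ht : 0 ≤ t := hs.trans hst
  set c := (1 - r ^ 2) / 4 * lowerIndex A with hcdef
  have hc : 0 < c := by
    have : 0 < 1 - r ^ 2 := by nlinarith
    positivity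
  obtain ⟨T, ⟨-, hinv⟩, htT⟩ :=
    ((hf.eventually_injOn hh hA hnorm hpoly hc t).and (eventually_ge_atTop t)).exists
  have hnear : ∀ {w : Cn n}, ‖w‖ < r → ∀ᶠ y in 𝓝 w, ‖y‖ ≤ r := fun hw =>
    (continuous_norm.tendsto _).eventually (Iic_mem_nhds hw)
  have hmem : ∀ {w : Cn n}, ‖w‖ ≤ r → w ∈ unitBall n := fun hw => by
    rw [mem_ball_zero_iff]; linarith
  -- Up to the late time `T`, the inner-factor criterion applies to `f(v(·,σ,T),T) = f(·,σ)`, as the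
  -- trajectories end where `Df(·,T)` is invertible. Both `σ = s` and `σ = t` are needed.
  have hlate : ∀ σ, 0 ≤ σ → σ ≤ t → ∀ w : Cn n, ‖w‖ < r →
      DifferentiableAt ℂ (fun y => v y σ T) w := by
    intro σ hσ hσt w hw
    have hσT := hσt.trans htT
    obtain ⟨C, -, hC⟩ := hv.exists_bilipschitz hh hA hr0 hr1 hσ hσT
    have hb : v w σ T ∈ closedBall (0 : Cn n) (Real.exp (-(c * (T - t)))) := by
      rw [mem_closedBall_zero_iff]
      refine (hv.norm_le_exp hh hA hr1 hw.le hσ hσT).trans ?_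
      rw [← hcdef]
      gcongr
    obtain ⟨L, hL⟩ := hinv _ hb
    refine differentiableAt_of_comp_eq (f := fun y => f y T) (F := fun y => f y σ) hL
      ((hf.holo σ hσ).differentiableAt (isOpen_ball.mem_nhds (hmem hw.le))) (C := C) ?_ ?_
    · filter_upwards [hnear hw] with y hy using (hC y w hy hw.le).1
    · filter_upwards [hnear hw] with y hy using
        hf.apply_evolution hh hA hpoly hv (hmem hy) hσ hσT
  obtain ⟨C, -, hC⟩ := hv.exists_bilipschitz hh hA hr0 hr1 hs hst
  obtain ⟨C', hC'0, hC'⟩ := hv.exists_bilipschitz hh hA hr0 hr1 ht htT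
  have hw : ‖v z s t‖ < r := (hv.norm_le z hz s t hs hst).trans_lt hzr
  have hd := (hlate t ht le_rfl _ hw).hasFDerivAt
  -- The reverse Lipschitz bound makes the derivative of `v(·,t,T)` at `v z s t` invertible, so the
  -- criterion applies again, now to `v(v(·,s,t),t,T) = v(·,s,T)`.
  obtain ⟨L, hL⟩ := exists_equiv_of_lower_bound _ (inv_pos.2 hC'0)
    (lower_bound_of_hasFDerivAt hC'0 hd (by
      filter_upwards [hnear hw] with y hy using (hC' y _ hy hw.le).2))
  rw [← hL] at hd
  refine differentiableAt_of_comp_eq (f := fun y => v y t T) (F := fun y => v y s T) hd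
    (hlate s hs hst z hzr) (C := C) ?_ ?_
  · filter_upwards [hnear hzr] with y hy using (hC y z hy hzr.le).1
  · filter_upwards [hnear hzr] with y hy using hv.comp hh hA (hmem hy) hs hst htT

end LoewnerPDE

theorem mainTheorem6 (n : ℕ) (A : LoewnerPDE.Cn n →L[ℂ] LoewnerPDE.Cn n)
    (hA : 0 < LoewnerPDE.lowerIndex A)
    (h : LoewnerPDE.Cn n → ℝ → LoewnerPDE.Cn n) (hh : LoewnerPDE.MemHA A h)
    (f : LoewnerPDE.Cn n → ℝ → LoewnerPDE.Cn n) (hf : LoewnerPDE.IsSolution h f)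
    (hnorm : LoewnerPDE.IsNormalized f) (hpoly : LoewnerPDE.PolyBounded A f) :
    LoewnerPDE.IsLoewnerChain f := by
  obtain ⟨v, hv⟩ := hh.exists_isEvolution hA
  refine ⟨hf.holo, fun t ht => hf.injOn hh hA hnorm hpoly hv ht,
    v, fun s t hs hst => ⟨hf.differentiableOn_evolution hh hA hnorm hpoly hv hs hst,
      fun z hz => hv.mem_unitBall hz hs hst, ?_,
      fun z hz => (hf.apply_evolution hh hA hpoly hv hz hs hst).symm⟩⟩
  simpa using hv.norm_le 0 (by simp) s t hs hst
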